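/- Notation. Let $N\ge 1$; $|\cdot|$ is the Euclidean norm. A \emph{weight function} is a continuous increasing (i.e. non-decreasing) $\omega:[0,\infty)\to[0,\infty)$ such that: $(\alpha)$ there is $K\ge1$ with $\omega(2t)\le K(1+\omega(t))$ for all $t\ge0$; $(\beta)$ $\omega(t)=o(t)$ as $t\to\infty$; $(\gamma)$ there are $a\in\mathbb R$, $b>0$ with $\omega(t)\ge a+b\log(1+t)$ for all $t\ge0$; $(\delta)$ $t\mapsto\omega(e^t)$ is convex. Put $\omega(x):=\omega(|x|)$ on $\mathbb R^N$ and $\omega(x,\xi):=\omega(|(x,\xi)|)$ on $\mathbb R^{2N}$. Let $\hat f(\xi)=\int_{\mathbb R^N}e^{-ix\xi}f(x)\,dx$, and let $\mathcal S_\omega(\mathbb R^N)$ be the set of all complex-valued $f\in L^1(\mathbb R^N)$ with $f,\hat f\in C^\infty(\mathbb R^N)$ and $\|e^{\lambda\omega}\partial^\beta f\|_\infty<\infty$, $\|e^{\lambda\omega}\partial^\beta\hat f\|_\infty<\infty$ for every $\lambda>0$ and every multi-index $\beta$. For $\tau\in(0,1)$ let $$\mathrm{Wig}_\tau(f)(x,\xi)=\int_{\mathbb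 R^N}e^{-it\xi}f(x+\tau t)\overline{f(x-(1-\tau)t)}\,dt .$$ Proposition. Let $\omega$ be a weight function, let $K$ and $b$ be any constants for which $(\alpha)$ and $(\gamma)$ hold, and let $\tau\in(0,1)$. (i) Let $\alpha>N$. For every $\lambda,\mu\ge0$ and $\mu'>\frac{2N}{b}$ there is a constant $C_{\lambda,\mu,\mu'}>0$ such that for every Lebesgue measurable set $E\subset\mathbb R^N$, every $\overline z\in\mathbb R^{2N}$ and every $f\in\mathcal S_\omega(\mathbb R^N)$ $$\int_E e^{2\lambda\omega(\xi)}|\hat f(\xi)|^2\,d\xi\le C_{\lambda,\mu,\mu'}\,D_\mu(E)\,\|e^{\lambda'\omega}\mathrm{Wig}_\tau(f)\|_2^{1-\frac N\alpha}\,\big\||z-\overline z|^\alpha e^{\lambda'\omega}\mathrm{Wig}_\tau(f)\big\|_2^{\frac N\alpha},$$ where $\lambda':=2K[K(\lambda+\mu)+\mu']$ and $D_\mu(E):=\int_E e^{-2\mu\omega(\xi)}\,d\xi\in[0,\infty]$. (ii) Let $\alpha>\frac N2$. For every $\lambda,\mu\ge0$ and $\mu'>\frac{2N}{b}(K^2+2)$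 there is a constant $C_{\lambda,\mu,\mu'}>0$ such that for every Lebesgue measurable set $E\subset\mathbb R^{2N}$, every $\overline z=(\overline x,\overline\xi)\in\mathbb R^{2N}$ and every $f\in\mathcal S_\omega(\mathbb R^N)$ $$\int_E e^{\lambda\omega(x,\xi)}|\mathrm{Wig}_\tau(f)(x,\xi)|\,dx\,d\xi\le C_{\lambda,\mu,\mu'}\,D'_\mu(E)\,\|e^{\lambda'\omega}f\|_2^{1-\frac N{2\alpha}}\,\big\|e^{\lambda'\omega}|x-\overline x|^\alpha f\big\|_2^{\frac N{2\alpha}}\,\|e^{\lambda'\omega}\hat f\|_2^{1-\frac N{2\alpha}}\,\big\|e^{\lambda'\omega}|\xi-\overline\xi|^\alpha\hat f\big\|_2^{\frac N{2\alpha}},$$ where $\lambda':=K^2[8K^4(\lambda+\mu)+\mu']$ and $D'_\mu(E):=\int_E e^{-\mu\omega(x,\xi)}\,dx\,d\xi\in[0,\infty]$. The constants may depend on $N,\omega,K,b,\tau,\alpha,\lambda,\mu,\mu'$, but not on $E$, $\overline z$, $f$. If $D_\mu(E)$ or $D'_\mu(E)$ is infinite, the right-hand side is read with $\infty\cdot0=0$.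 -/

import Mathlib

open MeasureTheory Set Filter Asymptotics
open scoped ENNReal

namespace TimeFreq

/-- Weight functions (Braun-Meise-Taylor). Only the values on `[0, ∞)` matter. -/
structure IsWeight (ω : ℝ → ℝ) : Prop where
  continuousOn : ContinuousOn ω (Ici 0)
  monotoneOn : MonotoneOn ω (Ici 0)
  nonneg : ∀ t, 0 ≤ t → 0 ≤ ω t
  doubling : ∃ K : ℝ, 1 ≤ K ∧ ∀ t, 0 ≤ t → ω (2 * t) ≤ K * (1 + ω t)
  isLittleO : ω =o[atTop] (fun t : ℝ => t)
  log_le : ∃ a b : ℝ, 0 < b ∧ ∀ t, 0 ≤ t → a + b * Real.log (1 + t) ≤ ω t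
  convex : ConvexOn ℝ univ (fun t : ℝ => ω (Real.exp t))

/-- `K` is an admissible constant in the doubling condition on `ω`. -/
def IsDoublingConst (ω : ℝ → ℝ) (K : ℝ) : Prop :=
  1 ≤ K ∧ ∀ t, 0 ≤ t → ω (2 * t) ≤ K * (1 + ω t)

/-- `b` is an admissible constant in the logarithmic lower bound on `ω`. -/
def IsLogConst (ω : ℝ → ℝ) (b : ℝ) : Prop :=
  0 < b ∧ ∃ a : ℝ, ∀ t, 0 ≤ t → a + b * Real.log (1 + t) ≤ ω t

/-- `ℝ^N` with its Euclidean norm and Lebesgue measure. -/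
abbrev RN (N : ℕ) : Type := EuclideanSpace ℝ (Fin N)

/-- The Euclidean norm of `z = (x, ξ) ∈ ℝ^{2N}`, where `ℝ^{2N}` is written as `ℝ^N × ℝ^N`
(with the product Lebesgue measure); the norm instance on the product is the sup norm. -/
noncomputable def phaseNorm {N : ℕ} (z : RN N × RN N) : ℝ :=
  Real.sqrt (‖z.1‖ ^ 2 + ‖z.2‖ ^ 2)

/-- The Fourier transform `f̂(ξ) = ∫ e^{-i x·ξ} f(x) dx`. -/
noncomputable def fourierT {N : ℕ} (f : RN N → ℂ) (ξ : RN N) : ℂ :=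
  ∫ x : RN N, Complex.exp (-(Complex.I * ((inner ℝ x ξ : ℝ) : ℂ))) * f x

/-- The space `S_ω(ℝ^N)`. Bounding the norm of the `n`-th derivative for all `n` is the same as
bounding all partial derivatives. -/
structure MemSω (ω : ℝ → ℝ) {N : ℕ} (f : RN N → ℂ) : Prop where
  integrable : Integrable f
  smooth : ContDiff ℝ ((⊤ : ℕ∞) : WithTop ℕ∞) f
  smooth_fourier : ContDiff ℝ ((⊤ : ℕ∞) : WithTop ℕ∞) (fourierT f)
  decay : ∀ l : ℝ, 0 < l → ∀ n : ℕ, ∃ C : ℝ, ∀ x : RN N,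
    Real.exp (l * ω ‖x‖) * ‖iteratedFDeriv ℝ n f x‖ ≤ C
  decay_fourier : ∀ l : ℝ, 0 < l → ∀ n : ℕ, ∃ C : ℝ, ∀ ξ : RN N,
    Real.exp (l * ω ‖ξ‖) * ‖iteratedFDeriv ℝ n (fourierT f) ξ‖ ≤ C

/-- The `τ`-Wigner transform
`Wig_τ f (x, ξ) = ∫ e^{-i t·ξ} f(x + τ t) conj(f(x - (1 - τ) t)) dt`. -/
noncomputable def wig {N : ℕ} (τ : ℝ) (f : RN N → ℂ) (z : RN N × RN N) : ℂ :=
  ∫ t : RN N, Complex.exp (-(Complex.I * ((inner ℝ t z.2 : ℝ) : ℂ))) *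
    (f (z.1 + τ • t) * (starRingEnd ℂ) (f (z.1 - (1 - τ) • t)))

end TimeFreq

namespace TimeFreq

/-! ### Growth and slow variation of weight functions. -/

namespace IsWeight

variable {ω : ℝ → ℝ}

/-! Both estimates factor `exp (-μω)` out of the integrand and reduce to a uniform pointwise bound
by weighted `L¹` norms. These are then interpolated between an `L²` norm and the `L²` norm with
weight `|z - z₀|^α` (`exists_lintegral_enorm_le`). The exponent is `d / (2α)`, which is `N/α` on
phase space (`d = 2N`) and `N/(2α)` on `ℝ^N`.

For (i), let `M` be the `L¹` norm of `exp (l ω) Wig f`. The two marginals of the Wigner transform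
are `|f̂|²` and, up to `(2π)^N`, `|f|²`, so `M` controls `∫ exp (l ω) |f̂|²` and `∫ exp (l ω) |f|²`.
A local Sobolev-type argument (`exists_weight_mul_fourier_sq_le`) turns these into a pointwise bound
on `exp (L ω) |f̂|²` by a multiple of `M`: the first integral carries the weight in frequency, the
second bounds a polynomial moment of `f` by `(γ)` and so supplies the regularity of `f̂`. Passing
from integrals to a point costs only `N < b (l - L)`. Frequency localization is harmless because a
bounded translation changes `ω` by a bounded amount (`IsWeight.exists_add_le`).

For (ii), `x` is a convex combination of the two arguments `x + τt` and `x - (1-τ)t`, so a weight at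
`x` is at most the sum of the weights there. One factor of the integrand absorbs the weight, the
other is bounded by its supremum, hence by `∫ |f̂|`. Rewriting the transform in terms of `f̂` gives
the same for `ξ`. Doubling combines the two into a bound on `exp (ν ω) |Wig f|` by the product of
the weighted `L¹` norms of `f` and `f̂` (`exists_weight_mul_wig_le`). -/

theorem exists_le_linear (hω : IsWeight ω) :
    ∃ C : ℝ, 0 ≤ C ∧ ∀ t, 0 ≤ t → ω t ≤ C * (1 + t) := by
  have h := hω.isLittleO.bound (c := 1) one_pos
  obtain ⟨T, hT⟩ := eventually_atTop.1 h
  have hT0 : 0 ≤ max T 0 := le_max_right _ _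
  refine ⟨max (ω (max T 0)) 1, le_max_of_le_right zero_le_one, fun t ht => ?_⟩
  rcases le_total t (max T 0) with h1 | h1
  · have := hω.monotoneOn ht hT0 h1
    have h2 : ω (max T 0) ≤ max (ω (max T 0)) 1 := le_max_left _ _
    have h3 : 0 ≤ max (ω (max T 0)) 1 := le_max_of_le_right zero_le_one
    nlinarith
  · have h4 := hT t ((le_max_left _ _).trans h1)
    rw [Real.norm_eq_abs, Real.norm_eq_abs, abs_of_nonneg ht, one_mul] at h4
    have h2 : 1 ≤ max (ω (max T 0)) 1 := le_max_right _ _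
    nlinarith [le_abs_self (ω t)]

/-- Logarithmic convexity and `ω(t) = o(t)` make `ω` slowly varying under translation. -/
theorem exists_add_le (hω : IsWeight ω) {c : ℝ} (hc : 0 < c) :
    ∃ C : ℝ, ∀ t, 0 ≤ t → ω (t + c) ≤ ω t + C := by
  obtain ⟨A, hA, hlin⟩ := hω.exists_le_linear
  set e := Real.exp 1
  have he : 0 < e := Real.exp_pos 1
  refine ⟨max (A * (2 + c)) (c * (A * (1 + e * (1 + c)))), fun t ht => ?_⟩
  rcases le_total t 1 with h1 | h1
  · have h2 := hlin (t + c) (by positivity)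
    have h3 := hω.nonneg t ht
    have h4 : A * (1 + (t + c)) ≤ A * (2 + c) := mul_le_mul_of_nonneg_left (by linarith) hA
    linarith [le_max_left (A * (2 + c)) (c * (A * (1 + e * (1 + c))))]
  · have ht0 : 0 < t := by linarith
    have htc : 0 < t + c := by linarith
    have hlt : Real.log t < Real.log (t + c) := Real.log_lt_log ht0 (by linarith)
    -- By convexity of `s ↦ ω (exp s)`, the slope on `[log t, log (t+c)]` is at most that on the
    -- following unit interval, which is `O(t)` by the linear bound. The first interval has length
    -- at most `c/t`, so the increment stays bounded.
    have hs := hω.convex.slope_mono_adjacent (mem_univ (Real.log t))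
      (mem_univ (Real.log (t + c) + 1)) hlt (lt_add_one _)
    simp only [Real.exp_add, Real.exp_log ht0, Real.exp_log htc, add_sub_cancel_left,
      div_one] at hs
    rw [div_le_iff₀ (by linarith)] at hs
    have h5 : Real.log (t + c) - Real.log t ≤ c / t := by
      rw [← Real.log_div htc.ne' ht0.ne']
      refine (Real.log_le_sub_one_of_pos (by positivity)).trans_eq ?_
      field_simp
      ring
    have h6 : ω ((t + c) * e) - ω (t + c) ≤ A * (1 + (t + c) * e) := by
      linarith [hlin ((t + c) * e) (by positivity), hω.nonneg (t + c) htc.le]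
    have h7 : (ω ((t + c) * e) - ω (t + c)) * (Real.log (t + c) - Real.log t)
        ≤ (A * (1 + (t + c) * e)) * (c / t) :=
      mul_le_mul h6 h5 (by linarith) (by positivity)
    have h8 : (A * (1 + (t + c) * e)) * (c / t) ≤ c * (A * (1 + e * (1 + c))) := by
      rw [mul_div_assoc', div_le_iff₀ ht0]
      have : (1 + (t + c) * e) ≤ (1 + e * (1 + c)) * t := by nlinarith [mul_pos he hc]
      have := mul_le_mul_of_nonneg_left this (mul_nonneg hA hc.le)
      nlinarith
    linarith [le_max_right (A * (2 + c)) (c * (A * (1 + e * (1 + c))))]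

theorem continuous_comp (hω : IsWeight ω) {X : Type*} [TopologicalSpace X] {u : X → ℝ}
    (hu : Continuous u) (h0 : ∀ x, 0 ≤ u x) : Continuous fun x => ω (u x) :=
  hω.continuousOn.comp_continuous hu h0

end IsWeight

theorem IsLogConst.exists_rpow_le {ω : ℝ → ℝ} {b : ℝ} (hb : IsLogConst ω b) {l : ℝ} (hl : 0 ≤ l) :
    ∃ C : ℝ, 0 < C ∧ ∀ t, 0 ≤ t → (1 + t) ^ (b * l) ≤ C * Real.exp (l * ω t) := by
  obtain ⟨-, a, ha⟩ := hb
  refine ⟨Real.exp (-(l * a)), Real.exp_pos _, fun t ht => ?_⟩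
  rw [Real.rpow_def_of_pos (by linarith), ← Real.exp_add]
  refine Real.exp_le_exp.2 ?_
  nlinarith [mul_le_mul_of_nonneg_left (ha t ht) hl]

/-! ### The Euclidean norm on phase space, and `S_ω` inside the Schwartz space. -/

theorem continuous_phaseNorm {N : ℕ} : Continuous (phaseNorm (N := N)) := by
  unfold phaseNorm
  fun_prop

theorem phaseNorm_nonneg {N : ℕ} (z : RN N × RN N) : 0 ≤ phaseNorm z := Real.sqrt_nonneg _

theorem norm_fst_le_phaseNorm {N : ℕ} (z : RN N × RN N) : ‖z.1‖ ≤ phaseNorm z :=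
  Real.le_sqrt_of_sq_le (by nlinarith [sq_nonneg ‖z.2‖])

theorem norm_snd_le_phaseNorm {N : ℕ} (z : RN N × RN N) : ‖z.2‖ ≤ phaseNorm z :=
  Real.le_sqrt_of_sq_le (by nlinarith [sq_nonneg ‖z.1‖])

theorem norm_le_phaseNorm {N : ℕ} (z : RN N × RN N) : ‖z‖ ≤ phaseNorm z :=
  max_le (norm_fst_le_phaseNorm z) (norm_snd_le_phaseNorm z)

theorem phaseNorm_le {N : ℕ} (z : RN N × RN N) : phaseNorm z ≤ 2 * max ‖z.1‖ ‖z.2‖ := by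
  refine Real.sqrt_le_iff.2 ⟨by positivity, ?_⟩
  have h1 : ‖z.1‖ ≤ max ‖z.1‖ ‖z.2‖ := le_max_left _ _
  have h2 : ‖z.2‖ ≤ max ‖z.1‖ ‖z.2‖ := le_max_right _ _
  nlinarith [norm_nonneg z.1, norm_nonneg z.2]

theorem exists_schwartzMap {ω : ℝ → ℝ} {b : ℝ} (hb : IsLogConst ω b) {N : ℕ}
    {f : RN N → ℂ} (hf : MemSω ω f) : ∃ F : SchwartzMap (RN N) ℂ, ∀ x, F x = f x := by
  refine ⟨⟨f, hf.smooth, fun k n => ?_⟩, fun x => rfl⟩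
  have hb0 := hb.1
  -- With `k + 1` in place of `k` the rate stays positive at `k = 0`, as the decay condition
  -- requires.
  have hl : 0 < (k + 1 : ℝ) / b := by positivity
  obtain ⟨C, hC0, hC⟩ := hb.exists_rpow_le hl.le
  obtain ⟨D, hD⟩ := hf.decay _ hl n
  refine ⟨C * D, fun x => ?_⟩
  have h1 : ‖x‖ ^ k ≤ (1 + ‖x‖) ^ (b * ((k + 1 : ℝ) / b)) := by
    rw [mul_div_cancel₀ _ hb0.ne', ← Nat.cast_succ, Real.rpow_natCast, Nat.succ_eq_add_one, pow_succ]
    have := norm_nonneg x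
    calc ‖x‖ ^ k ≤ (1 + ‖x‖) ^ k := by gcongr; linarith
      _ ≤ (1 + ‖x‖) ^ k * (1 + ‖x‖) := le_mul_of_one_le_right (by positivity) (by linarith)
  calc ‖x‖ ^ k * ‖iteratedFDeriv ℝ n f x‖
      ≤ (C * Real.exp ((k + 1 : ℝ) / b * ω ‖x‖)) * ‖iteratedFDeriv ℝ n f x‖ := by
        gcongr
        exact h1.trans (hC _ (norm_nonneg x))
    _ ≤ C * D := by
        rw [mul_assoc]
        gcongr
        exact hD x

/-! ### Interpolating `L¹` between weighted `L²` norms. -/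

section Interpolation

variable {V : Type*} [NormedAddCommGroup V] [NormedSpace ℝ V] [FiniteDimensional ℝ V]
  [MeasurableSpace V] [BorelSpace V] (μ : Measure V) [μ.IsAddHaarMeasure]

theorem lintegral_comp_smul (f : V → ℝ≥0∞) {r : ℝ} (hr : r ≠ 0) :
    ∫⁻ x, f (r • x) ∂μ = ENNReal.ofReal |(r ^ Module.finrank ℝ V)⁻¹| * ∫⁻ x, f x ∂μ := by
  have h := (Homeomorph.smulOfNeZero r hr (α := V)).measurableEmbedding.lintegral_map (μ := μ) f
  rw [show ⇑(Homeomorph.smulOfNeZero r hr (α := V)) = fun x => r • x from rfl,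
    Measure.map_addHaar_smul μ hr, lintegral_smul_measure, smul_eq_mul] at h
  exact h.symm

theorem lintegral_one_add_norm_rpow_lt_top {α : ℝ} (hα0 : 0 < α)
    (hα : (Module.finrank ℝ V : ℝ) < 2 * α) :
    ∫⁻ x : V, ENNReal.ofReal ((1 + ‖x‖ ^ α)⁻¹) ^ (2 : ℝ) ∂μ < ∞ := by
  have key : ∀ t : ℝ, 0 ≤ t → ((1 + t ^ α)⁻¹) ^ (2 : ℝ) ≤ (2 ^ α) ^ (2 : ℝ) * (1 + t) ^ (-(2 * α)) := by
    intro t ht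
    have h1 : (1 + t) ^ α ≤ 2 ^ α * (1 + t ^ α) := by
      have hm : 0 ≤ max 1 t := le_max_of_le_right ht
      calc (1 + t) ^ α ≤ (2 * max 1 t) ^ α := by
            gcongr
            linarith [le_max_left 1 t, le_max_right 1 t]
        _ = 2 ^ α * max 1 t ^ α := Real.mul_rpow zero_le_two hm
        _ ≤ 2 ^ α * (1 + t ^ α) := by
            gcongr
            have := Real.rpow_nonneg ht α
            rcases max_cases 1 t with ⟨h, -⟩ | ⟨h, -⟩ <;> rw [h]
            · simpa using this
            · linarith
    have h2 : 0 < (1 + t) ^ α := by positivity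
    have h3 : 0 < 1 + t ^ α := by positivity
    have h4 : (1 + t ^ α)⁻¹ ≤ 2 ^ α * ((1 + t) ^ α)⁻¹ := by
      rw [← div_eq_mul_inv, inv_eq_one_div, div_le_div_iff₀ h3 h2]
      linarith
    calc ((1 + t ^ α)⁻¹) ^ (2 : ℝ) ≤ (2 ^ α * ((1 + t) ^ α)⁻¹) ^ (2 : ℝ) := by gcongr
      _ = _ := by
        rw [Real.mul_rpow (by positivity) (by positivity), ← Real.rpow_neg (by positivity)]
        congr 1
        rw [← Real.rpow_mul (by positivity), neg_mul, mul_comm α 2]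
  calc ∫⁻ x : V, ENNReal.ofReal ((1 + ‖x‖ ^ α)⁻¹) ^ (2 : ℝ) ∂μ
      ≤ ∫⁻ x : V, ENNReal.ofReal ((2 ^ α) ^ (2 : ℝ)) * ENNReal.ofReal ((1 + ‖x‖) ^ (-(2 * α))) ∂μ := by
        refine lintegral_mono fun x => ?_
        rw [ENNReal.ofReal_rpow_of_nonneg (by positivity) zero_le_two,
          ← ENNReal.ofReal_mul (by positivity)]
        exact ENNReal.ofReal_le_ofReal (key _ (norm_nonneg x))
    _ < ∞ := by
        rw [lintegral_const_mul' _ _ ENNReal.ofReal_ne_top]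
        exact ENNReal.mul_lt_top ENNReal.ofReal_lt_top (finite_integral_one_add_norm hα)

/-- Cauchy–Schwarz after writing `g = u⁻¹ · (u g)` with `u = 1 + |(z - z₀)/R|^α`. Translation and
dilation evaluate the norm of `u⁻¹`, and Minkowski splits that of `u g`. The free radius `R` is
optimized afterwards. -/
theorem lintegral_enorm_le_scaled {α : ℝ} {g : V → ℂ} (hg : AEStronglyMeasurable g μ)
    (z₀ : V) {R : ℝ} (hR : 0 < R) :
    ∫⁻ z, ‖g z‖ₑ ∂μ ≤
      (ENNReal.ofReal (R ^ Module.finrank ℝ V) *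
        ∫⁻ x : V, ENNReal.ofReal ((1 + ‖x‖ ^ α)⁻¹) ^ (2 : ℝ) ∂μ) ^ (1 / 2 : ℝ) *
      (eLpNorm g 2 μ + ENNReal.ofReal (R ^ (-α)) *
        eLpNorm (fun z => ((‖z - z₀‖ ^ α : ℝ) : ℂ) * g z) 2 μ) := by
  set u : V → ℝ := fun z => 1 + ‖R⁻¹ • (z - z₀)‖ ^ α with hu
  have hu0 : ∀ z, 0 < u z := fun z => by positivity
  have humeas : Measurable u := by fun_prop
  have h1 : ∫⁻ z, ‖g z‖ₑ ∂μ = ∫⁻ z, ((fun z => ENNReal.ofReal (u z)⁻¹) *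
      fun z => ‖(u z : ℂ) * g z‖ₑ) z ∂μ := by
    refine lintegral_congr fun z => ?_
    rw [Pi.mul_apply, enorm_mul, ← mul_assoc, ← ofReal_norm (u z : ℂ), Complex.norm_real,
      Real.norm_of_nonneg (hu0 z).le, ← ENNReal.ofReal_mul (by have := hu0 z; positivity),
      inv_mul_cancel₀ (hu0 z).ne', ENNReal.ofReal_one, one_mul]
  have hug : AEStronglyMeasurable (fun z => (u z : ℂ) * g z) μ :=
    (Complex.measurable_ofReal.comp humeas).aestronglyMeasurable.mul hg
  rw [h1]
  refine (ENNReal.lintegral_mul_le_Lp_mul_Lq μ Real.HolderConjugate.two_two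
    (humeas.inv.ennreal_ofReal).aemeasurable hug.enorm).trans ?_
  refine mul_le_mul' (le_of_eq ?_) ?_
  · congr 1
    have h2 : ∫⁻ z, ENNReal.ofReal (u z)⁻¹ ^ (2 : ℝ) ∂μ =
        ∫⁻ z, ENNReal.ofReal ((1 + ‖R⁻¹ • z‖ ^ α)⁻¹) ^ (2 : ℝ) ∂μ :=
      lintegral_sub_right_eq_self
        (fun z => ENNReal.ofReal ((1 + ‖R⁻¹ • z‖ ^ α)⁻¹) ^ (2 : ℝ)) z₀
    refine h2.trans ?_
    rw [lintegral_comp_smul μ (fun z => ENNReal.ofReal ((1 + ‖z‖ ^ α)⁻¹) ^ (2 : ℝ))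
      (inv_ne_zero hR.ne'), inv_pow, inv_inv, abs_of_pos (pow_pos hR _)]
  · have h3 : (∫⁻ z, ‖(u z : ℂ) * g z‖ₑ ^ (2 : ℝ) ∂μ) ^ (1 / 2 : ℝ)
        = eLpNorm (fun z => (u z : ℂ) * g z) 2 μ := by
      rw [eLpNorm_eq_lintegral_rpow_enorm_toReal two_ne_zero ENNReal.ofNat_ne_top]
      simp
    rw [h3]
    have h4 : (fun z => (u z : ℂ) * g z) =
        g + ((R ^ (-α) : ℝ) : ℂ) • fun z => ((‖z - z₀‖ ^ α : ℝ) : ℂ) * g z := by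
      funext z
      simp only [hu, Pi.add_apply, Pi.smul_apply, smul_eq_mul]
      rw [norm_smul, norm_inv, Real.norm_of_nonneg hR.le,
        Real.mul_rpow (by positivity) (norm_nonneg _), Real.inv_rpow hR.le,
        ← Real.rpow_neg hR.le]
      push_cast
      ring
    have hw : AEStronglyMeasurable (fun z => ((‖z - z₀‖ ^ α : ℝ) : ℂ) * g z) μ :=
      (Complex.measurable_ofReal.comp (by fun_prop)).aestronglyMeasurable.mul hg
    rw [h4]
    refine (eLpNorm_add_le hg (hw.const_smul _) one_le_two).trans ?_
    rw [eLpNorm_const_smul, ← ofReal_norm, Complex.norm_real,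
      Real.norm_of_nonneg (by positivity)]

/-- Interpolation of the `L¹` norm between the `L²` norm and a polynomially weighted `L²` norm. -/
theorem exists_lintegral_enorm_le [Nontrivial V] {α : ℝ}
    (hα : (Module.finrank ℝ V : ℝ) < 2 * α) :
    ∃ C : ℝ≥0∞, C ≠ ∞ ∧ ∀ g : V → ℂ, AEStronglyMeasurable g μ → ∀ z₀ : V,
      ∫⁻ z, ‖g z‖ₑ ∂μ ≤ C * eLpNorm g 2 μ ^ (1 - Module.finrank ℝ V / (2 * α)) *
        eLpNorm (fun z => ((‖z - z₀‖ ^ α : ℝ) : ℂ) * g z) 2 μ ^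
          (Module.finrank ℝ V / (2 * α)) := by
  set d := Module.finrank ℝ V with hd
  have hd0 : (0 : ℝ) < d := by exact_mod_cast Module.finrank_pos
  have hα0 : 0 < α := by linarith
  set θ : ℝ := d / (2 * α) with hθ
  have hθ0 : 0 < θ := by positivity
  have hθ1 : θ < 1 := by rw [hθ, div_lt_one (by positivity)]; exact hα
  set c := ∫⁻ x : V, ENNReal.ofReal ((1 + ‖x‖ ^ α)⁻¹) ^ (2 : ℝ) ∂μ with hc
  have hcfin : c ≠ ∞ := (lintegral_one_add_norm_rpow_lt_top μ hα0 hα).ne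
  have hcfin2 : c ^ (1 / 2 : ℝ) ≠ ∞ := ENNReal.rpow_ne_top_of_nonneg (by positivity) hcfin
  -- The summand `1` keeps the constant nonzero, so the right-hand side is `∞` whenever `A` or `B`
  -- is infinite and neither vanishes.
  refine ⟨2 * c ^ (1 / 2 : ℝ) + 1,
    ENNReal.add_ne_top.2 ⟨ENNReal.mul_ne_top ENNReal.ofNat_ne_top hcfin2, ENNReal.one_ne_top⟩,
    fun g hg z₀ => ?_⟩
  have hw : AEStronglyMeasurable (fun z => ((‖z - z₀‖ ^ α : ℝ) : ℂ) * g z) μ :=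
    (Complex.measurable_ofReal.comp (by fun_prop)).aestronglyMeasurable.mul hg
  set A := eLpNorm g 2 μ with hA
  set B := eLpNorm (fun z => ((‖z - z₀‖ ^ α : ℝ) : ℂ) * g z) 2 μ with hB
  have hzero : g =ᵐ[μ] 0 → ∫⁻ z, ‖g z‖ₑ ∂μ = 0 := fun h => by
    rw [lintegral_eq_zero_iff' hg.enorm]
    filter_upwards [h] with z hz
    simp [hz]
  -- If either norm vanishes then `g = 0` almost everywhere; for `B` this uses that `{z₀}` is a null
  -- set.
  rcases eq_or_ne A 0 with hA0 | hA0
  · rw [hzero ((eLpNorm_eq_zero_iff hg two_ne_zero).1 hA0)]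
    exact zero_le
  rcases eq_or_ne B 0 with hB0 | hB0
  · have h1 := (eLpNorm_eq_zero_iff hw two_ne_zero).1 hB0
    rw [hzero]
    · exact zero_le
    · have h2 : ∀ᵐ z ∂μ, z ≠ z₀ := compl_mem_ae_iff.2 (measure_singleton z₀)
      filter_upwards [h1, h2] with z hz hz2
      have h3 : (((‖z - z₀‖ ^ α : ℝ) : ℂ)) ≠ 0 :=
        Complex.ofReal_ne_zero.2 (Real.rpow_pos_of_pos (norm_pos_iff.2 (sub_ne_zero.2 hz2)) _).ne'
      simpa [h3] using hz
  have hC0 : 2 * c ^ (1 / 2 : ℝ) + 1 ≠ 0 := by simp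
  rcases eq_or_ne A ∞ with hAt | hAt
  · rw [hAt, ENNReal.top_rpow_of_pos (by linarith), ENNReal.mul_top hC0,
      ENNReal.top_mul (by simp [hθ0.not_gt, hB0])]
    exact le_top
  rcases eq_or_ne B ∞ with hBt | hBt
  · rw [hBt, ENNReal.top_rpow_of_pos hθ0, ENNReal.mul_top]
    · exact le_top
    · refine mul_ne_zero hC0 ?_
      simp [hA0, hAt]
  have ha := ENNReal.toReal_pos hA0 hAt
  have hb := ENNReal.toReal_pos hB0 hBt
  set a := A.toReal
  set b := B.toReal
  have hAa : A = ENNReal.ofReal a := (ENNReal.ofReal_toReal hAt).symm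
  have hBb : B = ENNReal.ofReal b := (ENNReal.ofReal_toReal hBt).symm
  have hba : 0 < b / a := div_pos hb ha
  -- This radius balances the two terms: `R ^ (-α) * b = a`.
  have hR : 0 < (b / a) ^ (1 / α) := by positivity
  refine (lintegral_enorm_le_scaled μ (α := α) hg z₀ hR).trans ?_
  rw [← hA, ← hB, ← hc, ← hd, ENNReal.mul_rpow_of_nonneg _ _ (by norm_num),
    ENNReal.ofReal_rpow_of_nonneg (by positivity) (by norm_num), hAa, hBb,
    ← ENNReal.ofReal_mul (by positivity), ← ENNReal.ofReal_add (by positivity) (by positivity),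
    ENNReal.ofReal_rpow_of_pos ha, ENNReal.ofReal_rpow_of_pos hb]
  have e1 : ((b / a) ^ (1 / α)) ^ (-α) * b = a := by
    rw [← Real.rpow_mul hba.le, show 1 / α * -α = -1 by field_simp, Real.rpow_neg_one]
    field_simp
  have e2 : (((b / a) ^ (1 / α)) ^ d) ^ (1 / 2 : ℝ) * (a + a) = 2 * (a ^ (1 - θ) * b ^ θ) := by
    rw [← Real.rpow_natCast, ← Real.rpow_mul hba.le, ← Real.rpow_mul hba.le,
      show 1 / α * d * (1 / 2) = θ by rw [hθ]; field_simp, Real.div_rpow hb.le ha.le,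
      Real.rpow_sub ha, Real.rpow_one]
    field_simp
    ring
  rw [e1, mul_comm (ENNReal.ofReal _) (c ^ _), mul_assoc, ← ENNReal.ofReal_mul (by positivity), e2,
    mul_assoc (2 * c ^ (1 / 2 : ℝ) + 1), ← ENNReal.ofReal_mul (by positivity),
    ENNReal.ofReal_mul zero_le_two, ENNReal.ofReal_ofNat, ← mul_assoc, mul_comm _ (2 : ℝ≥0∞)]
  gcongr
  exact le_self_add

end Interpolation

theorem sq_lintegral_le {X : Type*} [MeasurableSpace X] {μ : Measure X} {h a b : X → ℝ≥0∞}
    (ha : AEMeasurable a μ) (hb : AEMeasurable b μ) (hle : ∀ x, h x ^ 2 ≤ a x * b x) :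
    (∫⁻ x, h x ∂μ) ^ 2 ≤ (∫⁻ x, a x ∂μ) * ∫⁻ x, b x ∂μ := by
  have h1 : ∫⁻ x, h x ∂μ ≤ (∫⁻ x, a x ∂μ) ^ (1 / 2 : ℝ) * (∫⁻ x, b x ∂μ) ^ (1 / 2 : ℝ) := by
    refine le_trans (lintegral_mono fun x => ?_)
      (ENNReal.lintegral_mul_norm_pow_le ha hb (p := 1 / 2) (q := 1 / 2) (by norm_num)
        (by norm_num) (by norm_num))
    rw [← ENNReal.mul_rpow_of_nonneg _ _ (by norm_num)]
    calc h x = (h x ^ 2) ^ (1 / 2 : ℝ) := by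
          rw [← ENNReal.rpow_natCast, ← ENNReal.rpow_mul]; norm_num
      _ ≤ _ := ENNReal.rpow_le_rpow (hle x) (by norm_num)
  calc (∫⁻ x, h x ∂μ) ^ 2
      ≤ ((∫⁻ x, a x ∂μ) ^ (1 / 2 : ℝ) * (∫⁻ x, b x ∂μ) ^ (1 / 2 : ℝ)) ^ 2 := by gcongr
    _ = _ := by
      rw [mul_pow, ← ENNReal.rpow_natCast, ← ENNReal.rpow_natCast, ← ENNReal.rpow_mul,
        ← ENNReal.rpow_mul]
      norm_num

/-! ### Pointwise bounds on a Fourier transform by frequency localization. -/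

section Localization

open FourierTransform
open scoped SchwartzMap

variable {V : Type*} [NormedAddCommGroup V] [InnerProductSpace ℝ V] [FiniteDimensional ℝ V]
  [MeasurableSpace V] [BorelSpace V]

theorem lintegral_one_add_norm_rpow_mul_schwartz_lt_top (g : 𝓢(V, ℂ)) (r : ℝ) :
    ∫⁻ x : V, ENNReal.ofReal ((1 + ‖x‖) ^ r) * ‖g x‖ₑ < ∞ := by
  obtain ⟨k, hk⟩ := exists_nat_gt (r + Module.finrank ℝ V)
  set D : ℝ := 2 ^ k * (Finset.Iic (k, 0)).sup (fun m => SchwartzMap.seminorm ℝ m.1 m.2) g with hD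
  have hdec : ∀ x, (1 + ‖x‖) ^ k * ‖g x‖ ≤ D := fun x => by
    simpa using SchwartzMap.one_add_le_sup_seminorm_apply (𝕜 := ℝ) (m := (k, 0)) le_rfl le_rfl g x
  calc ∫⁻ x : V, ENNReal.ofReal ((1 + ‖x‖) ^ r) * ‖g x‖ₑ
      ≤ ∫⁻ x : V, ENNReal.ofReal D * ENNReal.ofReal ((1 + ‖x‖) ^ (-((k : ℝ) - r))) := by
        refine lintegral_mono fun x => ?_
        have hx : 0 < 1 + ‖x‖ := by positivity
        have hD0 : 0 ≤ D := le_trans (by positivity) (hdec x)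
        rw [← ofReal_norm, ← ENNReal.ofReal_mul (by positivity), ← ENNReal.ofReal_mul hD0]
        refine ENNReal.ofReal_le_ofReal ?_
        rw [neg_sub, Real.rpow_sub hx, Real.rpow_natCast, mul_div_assoc',
          le_div_iff₀ (by positivity)]
        nlinarith [mul_le_mul_of_nonneg_left (hdec x) (Real.rpow_nonneg hx.le r)]
    _ < ∞ := by
        rw [lintegral_const_mul' _ _ ENNReal.ofReal_ne_top]
        exact ENNReal.mul_lt_top ENNReal.ofReal_lt_top
          (finite_integral_one_add_norm (by linarith))

/-- The windows are inverse Fourier transforms of translates of one bump, hence modulations of a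
single `γ`. Their common modulus is what makes later constants independent of `ξ₀`. -/
theorem exists_schwartz_window : ∃ γ : 𝓢(V, ℂ), ∀ ξ₀ : V, ∃ g : 𝓢(V, ℂ),
    (∀ x, ‖g x‖ = ‖γ x‖) ∧ 𝓕 g ξ₀ = 1 ∧ (∀ ξ, ‖𝓕 g ξ‖ ≤ 1) ∧ ∀ ξ, 1 ≤ ‖ξ - ξ₀‖ → 𝓕 g ξ = 0 := by
  let ψ : ContDiffBump (0 : V) := ⟨1 / 2, 1, by norm_num, by norm_num⟩
  have hsm : ∀ ξ₀ : V, ContDiff ℝ ((⊤ : ℕ∞) : WithTop ℕ∞) fun ξ => ((ψ (ξ - ξ₀) : ℝ) : ℂ) := fun ξ₀ =>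
    Complex.ofRealCLM.contDiff.comp (ψ.contDiff.comp (contDiff_id.sub contDiff_const))
  have hcs : ∀ ξ₀ : V, HasCompactSupport fun ξ => ((ψ (ξ - ξ₀) : ℝ) : ℂ) := fun ξ₀ => by
    have h := (ψ.hasCompactSupport.comp_homeomorph (Homeomorph.subRight ξ₀))
    exact h.comp_left (g := fun t : ℝ => (t : ℂ)) Complex.ofReal_zero
  let Ψ : V → 𝓢(V, ℂ) := fun ξ₀ => (hcs ξ₀).toSchwartzMap (hsm ξ₀)
  have hΨ : ∀ ξ₀ ξ, Ψ ξ₀ ξ = ((ψ (ξ - ξ₀) : ℝ) : ℂ) := fun _ _ => rfl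
  refine ⟨𝓕⁻ (Ψ 0), fun ξ₀ => ⟨𝓕⁻ (Ψ ξ₀), fun x => ?_, ?_, fun ξ => ?_, fun ξ hξ => ?_⟩⟩
  · rw [SchwartzMap.fourierInv_coe, SchwartzMap.fourierInv_coe, Real.fourierInv_eq',
      Real.fourierInv_eq', ← integral_add_right_eq_self _ ξ₀]
    have : ∀ v : V, Complex.exp (↑(2 * Real.pi * inner ℝ (v + ξ₀) x) * Complex.I) • (Ψ ξ₀) (v + ξ₀)
        = Complex.exp (↑(2 * Real.pi * inner ℝ ξ₀ x) * Complex.I) *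
          (Complex.exp (↑(2 * Real.pi * inner ℝ v x) * Complex.I) • (Ψ 0) v) := fun v => by
      rw [hΨ, hΨ, add_sub_cancel_right, sub_zero, inner_add_left, smul_eq_mul, smul_eq_mul,
        ← mul_assoc, ← Complex.exp_add]
      push_cast
      ring_nf
    simp_rw [this]
    rw [integral_const_mul, norm_mul, Complex.norm_exp_ofReal_mul_I, one_mul]
  · rw [FourierTransform.fourier_fourierInv_eq, hΨ, sub_self, ψ.one_of_mem_closedBall,
      Complex.ofReal_one]
    simp [ψ.rIn_pos.le]
  · rw [FourierTransform.fourier_fourierInv_eq, hΨ, Complex.norm_real,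
      Real.norm_of_nonneg ψ.nonneg]
    exact ψ.le_one
  · rw [FourierTransform.fourier_fourierInv_eq, hΨ, ψ.zero_of_le_dist, Complex.ofReal_zero]
    simpa [dist_eq_norm] using hξ

end Localization

section Localization

open FourierTransform
open scoped SchwartzMap

variable {V : Type*} [NormedAddCommGroup V] [InnerProductSpace ℝ V] [FiniteDimensional ℝ V]
  [MeasurableSpace V] [BorelSpace V]

theorem lintegral_enorm_sq_fourier (T : 𝓢(V, ℂ)) :
    ∫⁻ ξ, ‖𝓕 T ξ‖ₑ ^ 2 = ∫⁻ x, ‖T x‖ₑ ^ 2 := by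
  have key : ∀ S : 𝓢(V, ℂ), ∫⁻ x, ‖S x‖ₑ ^ 2 = ENNReal.ofReal (∫ x, ‖S x‖ ^ 2) := fun S => by
    have hi : Integrable fun x => ‖S x‖ ^ 2 := (memLp_two_iff_integrable_sq_norm
      S.continuous.aestronglyMeasurable).1 (S.memLp 2)
    rw [ofReal_integral_eq_lintegral_ofReal hi (ae_of_all _ fun x => by positivity)]
    refine lintegral_congr fun x => ?_
    rw [ENNReal.ofReal_pow (norm_nonneg _), ofReal_norm]
  rw [key, key, SchwartzMap.integral_norm_sq_fourier]

/-- A weighted Young inequality: Cauchy–Schwarz against the density `|g(x - t)|`,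
submultiplicativity `w x ≤ w t * w (x - t)` of the polynomial weight, then Tonelli. -/
theorem lintegral_weight_mul_conv_sq_le {r : ℝ} (hr : 0 ≤ r) {F g T : 𝓢(V, ℂ)}
    (hT : ∀ x, T x = ∫ t, F t * g (x - t)) :
    ∫⁻ x, ENNReal.ofReal ((1 + ‖x‖) ^ r) * ‖T x‖ₑ ^ 2 ≤
      (∫⁻ x, ‖g x‖ₑ) * (∫⁻ x, ENNReal.ofReal ((1 + ‖x‖) ^ r) * ‖g x‖ₑ) *
        ∫⁻ x, ENNReal.ofReal ((1 + ‖x‖) ^ r) * ‖F x‖ₑ ^ 2 := by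
  set w : V → ℝ≥0∞ := fun x => ENNReal.ofReal ((1 + ‖x‖) ^ r) with hw
  have hwm : Measurable w := by fun_prop
  have hFm : Measurable fun x => ‖F x‖ₑ := F.continuous.measurable.enorm
  have hgm : Measurable fun x => ‖g x‖ₑ := g.continuous.measurable.enorm
  have hwF : Measurable fun x => w x * ‖F x‖ₑ ^ 2 := hwm.mul (hFm.pow_const 2)
  have hwg : Measurable fun x => w x * ‖g x‖ₑ := hwm.mul hgm
  have hprod : Measurable fun p : V × V =>
      (w p.2 * ‖F p.2‖ₑ ^ 2) * (w (p.1 - p.2) * ‖g (p.1 - p.2)‖ₑ) :=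
    (hwF.comp measurable_snd).mul (hwg.comp (measurable_fst.sub measurable_snd))
  have hsub : ∀ x y, w x ≤ w y * w (x - y) := fun x y => by
    rw [hw, ← ENNReal.ofReal_mul (by positivity), ← Real.mul_rpow (by positivity) (by positivity)]
    refine ENNReal.ofReal_le_ofReal (Real.rpow_le_rpow (by positivity) ?_ hr)
    have : ‖x‖ ≤ ‖y‖ + ‖x - y‖ := by simpa using norm_add_le y (x - y)
    nlinarith [norm_nonneg y, norm_nonneg (x - y)]
  have hpt : ∀ x, ‖T x‖ₑ ^ 2 ≤ (∫⁻ t, ‖g t‖ₑ) * ∫⁻ t, ‖F t‖ₑ ^ 2 * ‖g (x - t)‖ₑ := fun x => by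
    have h1 : ‖T x‖ₑ ≤ ∫⁻ t, ‖F t‖ₑ * ‖g (x - t)‖ₑ := by
      rw [hT]
      refine (enorm_integral_le_lintegral_enorm _).trans_eq ?_
      simp_rw [enorm_mul]
    rw [← lintegral_sub_left_eq_self (fun t => ‖g t‖ₑ) x]
    calc ‖T x‖ₑ ^ 2 ≤ (∫⁻ t, ‖F t‖ₑ * ‖g (x - t)‖ₑ) ^ 2 := by gcongr
      _ ≤ _ := sq_lintegral_le (by fun_prop) (by fun_prop) fun t => le_of_eq (by ring)
  calc ∫⁻ x, w x * ‖T x‖ₑ ^ 2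
      ≤ ∫⁻ x, (∫⁻ t, ‖g t‖ₑ) * ∫⁻ t, (w t * ‖F t‖ₑ ^ 2) * (w (x - t) * ‖g (x - t)‖ₑ) := by
        refine lintegral_mono fun x => ?_
        calc w x * ‖T x‖ₑ ^ 2
            ≤ w x * ((∫⁻ t, ‖g t‖ₑ) * ∫⁻ t, ‖F t‖ₑ ^ 2 * ‖g (x - t)‖ₑ) := by gcongr; exact hpt x
          _ = (∫⁻ t, ‖g t‖ₑ) * ∫⁻ t, w x * (‖F t‖ₑ ^ 2 * ‖g (x - t)‖ₑ) := by
              rw [lintegral_const_mul' _ _ ENNReal.ofReal_ne_top]; ring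
          _ ≤ _ := by
              refine mul_le_mul_right (lintegral_mono fun t => ?_) _
              calc w x * (‖F t‖ₑ ^ 2 * ‖g (x - t)‖ₑ)
                  ≤ w t * w (x - t) * (‖F t‖ₑ ^ 2 * ‖g (x - t)‖ₑ) := by gcongr; exact hsub x t
                _ = _ := by ring
    _ = (∫⁻ t, ‖g t‖ₑ) * ∫⁻ x, ∫⁻ t, (w t * ‖F t‖ₑ ^ 2) * (w (x - t) * ‖g (x - t)‖ₑ) := by
        refine lintegral_const_mul _ (Measurable.lintegral_prod_right' hprod)
    _ = (∫⁻ t, ‖g t‖ₑ) * ∫⁻ t, ∫⁻ x, (w t * ‖F t‖ₑ ^ 2) * (w (x - t) * ‖g (x - t)‖ₑ) := by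
        rw [lintegral_lintegral_swap hprod.aemeasurable]
    _ = (∫⁻ t, ‖g t‖ₑ) * ∫⁻ t, (w t * ‖F t‖ₑ ^ 2) * ∫⁻ x, w x * ‖g x‖ₑ := by
        congr 1
        refine lintegral_congr fun t => ?_
        refine (lintegral_const_mul (w t * ‖F t‖ₑ ^ 2)
          (hwg.comp (measurable_id.sub_const t))).trans ?_
        exact congrArg _ (lintegral_sub_right_eq_self (fun x => w x * ‖g x‖ₑ) t)
    _ = _ := by
        rw [lintegral_mul_const _ (by fun_prop)]
        ring

/-- Weighted pointwise bound of the Fourier transform by weighted `L²` norms of the function and of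
its Fourier transform. -/
theorem exists_weight_mul_fourier_sq_le {v : V → ℝ≥0∞} {C₀ : ℝ≥0∞}
    (hC₀ : C₀ ≠ ∞) (hloc : ∀ ξ ξ₀, ‖ξ - ξ₀‖ ≤ 1 → v ξ₀ ≤ C₀ * v ξ) (hvt : ∀ ξ, v ξ ≠ ∞)
    {r θ : ℝ} (hr : 0 ≤ r) (hθ0 : 0 ≤ θ) (hθ1 : θ ≤ 1)
    (hθr : (Module.finrank ℝ V : ℝ) < θ * r) :
    ∃ C : ℝ≥0∞, C ≠ ∞ ∧ ∀ (F : 𝓢(V, ℂ)) (ξ₀ : V),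
      v ξ₀ ^ (1 - θ) * ‖𝓕 F ξ₀‖ₑ ^ 2 ≤ C * (∫⁻ ξ, v ξ * ‖𝓕 F ξ‖ₑ ^ 2) ^ (1 - θ) *
        (∫⁻ x, ENNReal.ofReal ((1 + ‖x‖) ^ r) * ‖F x‖ₑ ^ 2) ^ θ := by
  obtain ⟨γ, hγ⟩ := exists_schwartz_window (V := V)
  have h1θ : 0 ≤ 1 - θ := by linarith
  set S := ∫⁻ x : V, ENNReal.ofReal ((1 + ‖x‖) ^ (-(θ * r))) with hS
  set G := (∫⁻ x, ‖γ x‖ₑ) * (∫⁻ x, ENNReal.ofReal ((1 + ‖x‖) ^ r) * ‖γ x‖ₑ) with hG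
  have hSt : S ≠ ∞ := (finite_integral_one_add_norm hθr).ne
  have hGt : G ≠ ∞ := by
    refine ENNReal.mul_ne_top ?_ (lintegral_one_add_norm_rpow_mul_schwartz_lt_top γ r).ne
    simpa using (lintegral_one_add_norm_rpow_mul_schwartz_lt_top γ 0).ne
  refine ⟨S * (C₀ ^ (1 - θ) * G ^ θ), ENNReal.mul_ne_top hSt (ENNReal.mul_ne_top
    (ENNReal.rpow_ne_top_of_nonneg h1θ hC₀) (ENNReal.rpow_ne_top_of_nonneg hθ0 hGt)),
    fun F ξ₀ => ?_⟩
  obtain ⟨g, hgγ, hg1, hgle, hg0⟩ := hγ ξ₀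
  set P := ∫⁻ ξ, v ξ * ‖𝓕 F ξ‖ₑ ^ 2
  set Q := ∫⁻ x, ENNReal.ofReal ((1 + ‖x‖) ^ r) * ‖F x‖ₑ ^ 2
  -- `T` is `F` filtered to the unit ball about `ξ₀` in frequency, with its Fourier transform at
  -- `ξ₀` unchanged.
  set T : 𝓢(V, ℂ) := SchwartzMap.convolution (ContinuousLinearMap.mul ℂ ℂ) F g with hTdef
  have hT : ∀ x, T x = ∫ t, F t * g (x - t) := fun x => by
    rw [hTdef, SchwartzMap.convolution_apply, convolution_def]
    rfl
  have hFT : ∀ ξ, 𝓕 T ξ = 𝓕 F ξ * 𝓕 g ξ := fun ξ => by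
    rw [hTdef, SchwartzMap.fourier_convolution]
    rfl
  have hTm : Measurable fun x => ‖T x‖ₑ := T.continuous.measurable.enorm
  have hgγ' : ∀ x, ‖g x‖ₑ = ‖γ x‖ₑ := fun x => by rw [← ofReal_norm, hgγ, ofReal_norm]
  have s1 : ‖𝓕 F ξ₀‖ₑ ≤ ∫⁻ x, ‖T x‖ₑ := by
    have : 𝓕 F ξ₀ = 𝓕 T ξ₀ := by rw [hFT, hg1, mul_one]
    rw [this, SchwartzMap.fourier_coe, Real.fourier_eq]
    refine (enorm_integral_le_lintegral_enorm _).trans_eq (lintegral_congr fun x => ?_)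
    rw [← ofReal_norm, Circle.norm_smul, ofReal_norm]
  -- Cauchy–Schwarz against `(1 + |x|)^(-θr)`, integrable since `θ r` exceeds the dimension.
  have s2 : (∫⁻ x, ‖T x‖ₑ) ^ 2 ≤
      S * ∫⁻ x, ENNReal.ofReal ((1 + ‖x‖) ^ (θ * r)) * ‖T x‖ₑ ^ 2 := by
    refine sq_lintegral_le (by fun_prop) (by fun_prop) fun x => le_of_eq ?_
    have hx : 0 < 1 + ‖x‖ := by positivity
    rw [← mul_assoc, ← ENNReal.ofReal_mul (by positivity), ← Real.rpow_add hx, neg_add_cancel,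
      Real.rpow_zero, ENNReal.ofReal_one, one_mul]
  -- Hölder between the exponents `0` and `r` of the weight.
  have s3 : ∫⁻ x, ENNReal.ofReal ((1 + ‖x‖) ^ (θ * r)) * ‖T x‖ₑ ^ 2 ≤
      (∫⁻ x, ‖T x‖ₑ ^ 2) ^ (1 - θ) *
        (∫⁻ x, ENNReal.ofReal ((1 + ‖x‖) ^ r) * ‖T x‖ₑ ^ 2) ^ θ := by
    refine le_trans (le_of_eq (lintegral_congr fun x => ?_)) (ENNReal.lintegral_mul_norm_pow_le
      (by fun_prop) (by fun_prop) h1θ hθ0 (by ring))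
    rw [ENNReal.mul_rpow_of_nonneg _ _ hθ0, ENNReal.ofReal_rpow_of_nonneg (by positivity) hθ0,
      ← Real.rpow_mul (by positivity), mul_comm r θ, mul_left_comm,
      ← ENNReal.rpow_add_of_nonneg _ _ h1θ hθ0, sub_add_cancel, ENNReal.rpow_one]
  -- By Plancherel the integral lives on the unit ball about `ξ₀`, where `v ξ₀` is dominated by `C₀
  -- * v ξ`.
  have s4 : v ξ₀ * ∫⁻ x, ‖T x‖ₑ ^ 2 ≤ C₀ * P := by
    rw [← lintegral_enorm_sq_fourier, ← lintegral_const_mul' _ _ (hvt ξ₀),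
      ← lintegral_const_mul' _ _ hC₀]
    refine lintegral_mono fun ξ => ?_
    rw [hFT, enorm_mul]
    rcases le_total 1 ‖ξ - ξ₀‖ with h | h
    · simp [hg0 ξ h]
    · have : ‖𝓕 g ξ‖ₑ ≤ 1 := by
        rw [← ofReal_norm, ← ENNReal.ofReal_one]
        exact ENNReal.ofReal_le_ofReal (hgle ξ)
      calc v ξ₀ * (‖𝓕 F ξ‖ₑ * ‖𝓕 g ξ‖ₑ) ^ 2 ≤ (C₀ * v ξ) * (‖𝓕 F ξ‖ₑ * 1) ^ 2 := by
            gcongr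
            exact hloc ξ ξ₀ h
        _ = C₀ * (v ξ * ‖𝓕 F ξ‖ₑ ^ 2) := by ring
  have s5 : ∫⁻ x, ENNReal.ofReal ((1 + ‖x‖) ^ r) * ‖T x‖ₑ ^ 2 ≤ G * Q := by
    have := lintegral_weight_mul_conv_sq_le hr hT
    simp_rw [hgγ'] at this
    exact this
  calc v ξ₀ ^ (1 - θ) * ‖𝓕 F ξ₀‖ₑ ^ 2
      ≤ v ξ₀ ^ (1 - θ) * (S * ((∫⁻ x, ‖T x‖ₑ ^ 2) ^ (1 - θ) * (G * Q) ^ θ)) := by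
        gcongr
        refine le_trans (by gcongr) (s2.trans ?_)
        gcongr
        exact s3.trans (by gcongr)
    _ = S * ((v ξ₀ * ∫⁻ x, ‖T x‖ₑ ^ 2) ^ (1 - θ) * (G * Q) ^ θ) := by
        rw [ENNReal.mul_rpow_of_nonneg _ _ h1θ]
        ring
    _ ≤ S * ((C₀ * P) ^ (1 - θ) * (G * Q) ^ θ) := by gcongr
    _ = _ := by
        rw [ENNReal.mul_rpow_of_nonneg _ _ h1θ, ENNReal.mul_rpow_of_nonneg _ _ hθ0]
        ring

end Localization

/-! ### Marginals of the `τ`-Wigner transform. -/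

section Wigner

open FourierTransform
open scoped SchwartzMap ComplexConjugate

variable {N : ℕ} {τ : ℝ}

theorem fourierT_eq (f : RN N → ℂ) (ξ : RN N) : fourierT f ξ = 𝓕 f ((2 * Real.pi)⁻¹ • ξ) := by
  rw [Real.fourier_eq', fourierT]
  refine integral_congr_ae (ae_of_all _ fun x => ?_)
  have hpi : (Real.pi : ℝ) ≠ 0 := Real.pi_ne_zero
  simp only [smul_eq_mul, real_inner_smul_right]
  congr 2
  rw [show -2 * Real.pi * ((2 * Real.pi)⁻¹ * inner ℝ x ξ) = -inner ℝ x ξ by field_simp]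
  push_cast
  ring

theorem fourier_eq_fourierT (f : RN N → ℂ) (η : RN N) : 𝓕 f η = fourierT f ((2 * Real.pi) • η) := by
  rw [fourierT_eq, inv_smul_smul₀ (by positivity)]

theorem norm_exp_neg_I_mul (r : ℝ) : ‖Complex.exp (-(Complex.I * (r : ℂ)))‖ = 1 := by
  rw [show -(Complex.I * (r : ℂ)) = ((-r : ℝ) : ℂ) * Complex.I by push_cast; ring]
  exact Complex.norm_exp_ofReal_mul_I _

theorem measurable_wig (F : 𝓢(RN N, ℂ)) : Measurable (wig τ F) := by
  have hF := F.continuous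
  have h : StronglyMeasurable fun p : (RN N × RN N) × RN N =>
      Complex.exp (-(Complex.I * ((inner ℝ p.2 p.1.2 : ℝ) : ℂ))) *
        (F (p.1.1 + τ • p.2) * conj (F (p.1.1 - (1 - τ) • p.2))) := by
    refine Continuous.stronglyMeasurable ?_
    have h1 : Continuous fun p : (RN N × RN N) × RN N => F (p.1.1 + τ • p.2) :=
      hF.comp (by fun_prop)
    have h2 : Continuous fun p : (RN N × RN N) × RN N => F (p.1.1 - (1 - τ) • p.2) :=
      hF.comp (by fun_prop)
    have h3 : Continuous fun p : (RN N × RN N) × RN N => (inner ℝ p.2 p.1.2 : ℝ) := by fun_prop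
    exact (Complex.continuous_exp.comp (continuous_const.mul
      (Complex.continuous_ofReal.comp h3)).neg).mul (h1.mul (Complex.continuous_conj.comp h2))
  exact h.integral_prod_right'.measurable

/-- The phase is unimodular, and the rest is the integrand of a convolution of two integrable
functions. This licenses the Fubini steps of the frequency marginal. -/
theorem integrable_autocorrelation (F : 𝓢(RN N, ℂ)) (ξ : RN N) :
    Integrable (fun p : RN N × RN N => Complex.exp (-(Complex.I * ((inner ℝ p.1 ξ : ℝ) : ℂ))) *
      (F p.2 * conj (F (p.2 - p.1)))) (volume.prod volume) := by
  have hneg : Integrable fun y : RN N => conj (F (-y)) :=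
    (Complex.conjCLE : ℂ →L[ℝ] ℂ).integrable_comp (F.integrable (μ := volume)).comp_neg
  have h := Integrable.convolution_integrand (ContinuousLinearMap.mul ℂ ℂ)
    (F.integrable (μ := volume)) hneg
  simp only [ContinuousLinearMap.mul_apply', neg_sub] at h
  refine h.bdd_mul (c := 1) ?_ (ae_of_all _ fun p => (norm_exp_neg_I_mul _).le)
  exact Continuous.aestronglyMeasurable (by fun_prop)

/-- The frequency marginal of the `τ`-Wigner transform. -/
theorem integral_wig_fst (F : 𝓢(RN N, ℂ)) (ξ : RN N) :
    ∫ x, wig τ F (x, ξ) = fourierT F ξ * conj (fourierT F ξ) := by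
  set e : RN N → ℂ := fun t => Complex.exp (-(Complex.I * ((inner ℝ t ξ : ℝ) : ℂ))) with he
  have hint := integrable_autocorrelation F ξ
  -- The shear `x ↦ x + τt` reduces every `τ` to the plain autocorrelation `F x * conj (F (x - t))`.
  have hshear : MeasurePreserving (fun p : RN N × RN N => (p.1, p.2 + τ • p.1))
      (volume.prod volume) (volume.prod volume) :=
    (MeasurePreserving.id volume).skew_product (g := fun t x => x + τ • t) (by fun_prop)
      (ae_of_all _ fun t => map_add_right_eq_self volume (τ • t))
  have hint2 : Integrable (Function.uncurry fun t x : RN N =>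
      e t * (F (x + τ • t) * conj (F (x - (1 - τ) • t)))) (volume.prod volume) := by
    refine (hshear.integrable_comp_of_integrable hint).congr (ae_of_all _ fun p => ?_)
    simp only [Function.comp_apply, Function.uncurry, he]
    rw [show p.2 + τ • p.1 - p.1 = p.2 - (1 - τ) • p.1 by module]
  calc ∫ x, wig τ F (x, ξ) = ∫ x, ∫ t, e t * (F (x + τ • t) * conj (F (x - (1 - τ) • t))) := rfl
    _ = ∫ t, ∫ x, e t * (F (x + τ • t) * conj (F (x - (1 - τ) • t))) :=
        (integral_integral_swap hint2).symm
    _ = ∫ t, ∫ x, e t * (F x * conj (F (x - t))) := by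
        refine integral_congr_ae (ae_of_all _ fun t => ?_)
        have h := integral_add_right_eq_self (μ := volume)
          (fun x : RN N => e t * (F x * conj (F (x - t)))) (τ • t)
        simp only at h ⊢
        rw [← h]
        refine integral_congr_ae (ae_of_all _ fun x => ?_)
        simp only
        rw [show x + τ • t - t = x - (1 - τ) • t by module]
    _ = ∫ x, ∫ t, e t * (F x * conj (F (x - t))) := integral_integral_swap hint
    _ = ∫ x, e x * F x * conj (fourierT F ξ) := by
        refine integral_congr_ae (ae_of_all _ fun x => ?_)
        simp only
        -- Substituting `t ↦ x - t` separates the variables.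
        rw [← integral_sub_left_eq_self _ volume x, fourierT, ← integral_conj,
          ← integral_const_mul]
        refine integral_congr_ae (ae_of_all _ fun t => ?_)
        simp only [he, sub_sub_cancel, inner_sub_left, map_mul, ← Complex.exp_conj, map_neg,
          Complex.conj_I, Complex.conj_ofReal]
        rw [show -(Complex.I * ((inner ℝ x ξ - inner ℝ t ξ : ℝ) : ℂ)) =
          -(Complex.I * ((inner ℝ x ξ : ℝ) : ℂ)) + -(-Complex.I * ((inner ℝ t ξ : ℝ) : ℂ)) by
            push_cast; ring, Complex.exp_add]
        ring
    _ = fourierT F ξ * conj (fourierT F ξ) := by rw [integral_mul_const]; rfl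

theorem enorm_fourierT_sq_le (F : 𝓢(RN N, ℂ)) (ξ : RN N) :
    ‖fourierT F ξ‖ₑ ^ 2 ≤ ∫⁻ x, ‖wig τ F (x, ξ)‖ₑ := by
  refine le_trans (le_of_eq ?_) (enorm_integral_le_lintegral_enorm _)
  rw [integral_wig_fst, enorm_mul, ← ofReal_norm (conj _), RCLike.norm_conj, ofReal_norm, sq]

theorem integrable_wig_integrand (hτ0 : τ ≠ 0) (F : 𝓢(RN N, ℂ)) (x : RN N) :
    Integrable fun t => F (x + τ • t) * conj (F (x - (1 - τ) • t)) := by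
  have h1 : Integrable fun t => F (x + τ • t) := (F.integrable.comp_add_left x).comp_smul hτ0
  have hc : Continuous fun t => conj (F (x - (1 - τ) • t)) :=
    Complex.continuous_conj.comp (F.continuous.comp (by fun_prop))
  obtain ⟨C, -, hC⟩ := F.decay 0 0
  refine h1.mul_bdd (c := C) hc.aestronglyMeasurable (ae_of_all _ fun t => ?_)
  rw [RCLike.norm_conj]
  simpa using hC (x - (1 - τ) • t)

theorem fourier_wig_integrand (F : 𝓢(RN N, ℂ)) (x η : RN N) :
    𝓕 (fun t => F (x + τ • t) * conj (F (x - (1 - τ) • t))) η =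
      wig τ F (x, (2 * Real.pi) • η) := by
  rw [fourier_eq_fourierT]
  rfl

/-- For fixed `x` the Wigner transform is the Fourier transform of `h t = F (x + τt) * conj (F (x -
(1-τ)t))`, and `h 0 = |F x|²` is recovered by Fourier inversion. The factor `(2π)^(-N)` converts
between the two normalizations. -/
theorem enorm_sq_le_lintegral_wig (hτ0 : τ ≠ 0) (F : 𝓢(RN N, ℂ)) (x : RN N) :
    ‖F x‖ₑ ^ 2 ≤ ENNReal.ofReal |((2 * Real.pi) ^ N)⁻¹| * ∫⁻ ξ, ‖wig τ F (x, ξ)‖ₑ := by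
  set h : RN N → ℂ := fun t => F (x + τ • t) * conj (F (x - (1 - τ) • t)) with hh
  have hcont : Continuous h :=
    (F.continuous.comp (by fun_prop)).mul
      (Complex.continuous_conj.comp (F.continuous.comp (by fun_prop)))
  have hint : Integrable h := integrable_wig_integrand hτ0 F x
  have e1 := lintegral_comp_smul volume (fun ξ : RN N => ‖wig τ F (x, ξ)‖ₑ)
    (show (2 * Real.pi : ℝ) ≠ 0 by positivity)
  rw [finrank_euclideanSpace_fin] at e1
  have e2 : ∫⁻ η, ‖𝓕 h η‖ₑ = ∫⁻ η, ‖wig τ F (x, (2 * Real.pi) • η)‖ₑ :=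
    lintegral_congr fun η => by rw [hh, fourier_wig_integrand]
  rw [← e1, ← e2]
  -- Inversion needs an integrable Fourier transform; otherwise the bound is trivial.
  by_cases hfin : ∫⁻ η, ‖𝓕 h η‖ₑ = ∞
  · rw [hfin]; exact le_top
  have hFm : AEStronglyMeasurable (𝓕 h) volume := by
    have : 𝓕 h = fun η => wig τ F (x, (2 * Real.pi) • η) := by
      funext η; rw [hh, fourier_wig_integrand]
    rw [this]
    exact ((measurable_wig F).comp (by fun_prop)).aestronglyMeasurable
  have hFint : Integrable (𝓕 h) := ⟨hFm, lt_top_iff_ne_top.2 hfin⟩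
  have hinv := congrFun (hcont.fourierInv_fourier_eq hint hFint) 0
  rw [Real.fourierInv_eq'] at hinv
  have h0 : h 0 = F x * conj (F x) := by simp [hh]
  calc ‖F x‖ₑ ^ 2 = ‖h 0‖ₑ := by
        rw [h0, enorm_mul, ← ofReal_norm (conj _), RCLike.norm_conj, ofReal_norm, sq]
    _ ≤ ∫⁻ η, ‖𝓕 h η‖ₑ := by
        rw [← hinv]
        refine (enorm_integral_le_lintegral_enorm _).trans_eq ?_
        simp

end Wigner

/-! ### Weighted marginals and the concentration estimate for `f̂`. -/

section Marginals

open FourierTransform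
open scoped SchwartzMap ComplexConjugate

variable {N : ℕ} {τ : ℝ} {ω : ℝ → ℝ}

theorem IsWeight.exp_le_exp (hω : IsWeight ω) {l s t : ℝ} (hl : 0 ≤ l) (hs : 0 ≤ s) (hst : s ≤ t) :
    ENNReal.ofReal (Real.exp (l * ω s)) ≤ ENNReal.ofReal (Real.exp (l * ω t)) :=
  ENNReal.ofReal_le_ofReal (Real.exp_le_exp.2
    (mul_le_mul_of_nonneg_left (hω.monotoneOn hs (hs.trans hst) hst) hl))

theorem IsWeight.measurable_exp (hω : IsWeight ω) {X : Type*} [TopologicalSpace X]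
    [MeasurableSpace X] [OpensMeasurableSpace X] (l : ℝ) {u : X → ℝ}
    (hu : Continuous u) (h0 : ∀ x, 0 ≤ u x) :
    Measurable fun x => ENNReal.ofReal (Real.exp (l * ω (u x))) :=
  (Real.continuous_exp.comp (continuous_const.mul
    (hω.continuous_comp hu h0))).measurable.ennreal_ofReal

theorem measurable_weighted_wig (hω : IsWeight ω) (l : ℝ) (F : 𝓢(RN N, ℂ)) :
    Measurable fun z : RN N × RN N =>
      ENNReal.ofReal (Real.exp (l * ω (phaseNorm z))) * ‖wig τ F z‖ₑ :=
  (hω.measurable_exp l continuous_phaseNorm phaseNorm_nonneg).mul (measurable_wig F).enorm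

theorem lintegral_weight_fourierT_sq_le (hω : IsWeight ω) {l : ℝ} (hl : 0 ≤ l) (F : 𝓢(RN N, ℂ)) :
    ∫⁻ ξ : RN N, ENNReal.ofReal (Real.exp (l * ω ‖ξ‖)) * ‖fourierT F ξ‖ₑ ^ 2 ≤
      ∫⁻ z, ENNReal.ofReal (Real.exp (l * ω (phaseNorm z))) * ‖wig τ F z‖ₑ := by
  rw [show (volume : Measure (RN N × RN N)) = volume.prod volume from rfl,
    lintegral_prod_symm _ (measurable_weighted_wig hω l F).aemeasurable]
  refine lintegral_mono fun ξ => ?_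
  calc ENNReal.ofReal (Real.exp (l * ω ‖ξ‖)) * ‖fourierT F ξ‖ₑ ^ 2
      ≤ ENNReal.ofReal (Real.exp (l * ω ‖ξ‖)) * ∫⁻ x, ‖wig τ F (x, ξ)‖ₑ := by
        gcongr
        exact enorm_fourierT_sq_le F ξ
    _ = ∫⁻ x, ENNReal.ofReal (Real.exp (l * ω ‖ξ‖)) * ‖wig τ F (x, ξ)‖ₑ :=
        (lintegral_const_mul' _ _ ENNReal.ofReal_ne_top).symm
    _ ≤ _ := by
        refine lintegral_mono fun x => ?_
        exact mul_le_mul' (hω.exp_le_exp hl (norm_nonneg _) (norm_snd_le_phaseNorm (x, ξ))) le_rfl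

theorem lintegral_weight_sq_le (hω : IsWeight ω) (hτ0 : τ ≠ 0) {l : ℝ} (hl : 0 ≤ l)
    (F : 𝓢(RN N, ℂ)) :
    ∫⁻ x : RN N, ENNReal.ofReal (Real.exp (l * ω ‖x‖)) * ‖F x‖ₑ ^ 2 ≤
      ENNReal.ofReal |((2 * Real.pi) ^ N)⁻¹| *
        ∫⁻ z, ENNReal.ofReal (Real.exp (l * ω (phaseNorm z))) * ‖wig τ F z‖ₑ := by
  rw [show (volume : Measure (RN N × RN N)) = volume.prod volume from rfl,
    lintegral_prod _ (measurable_weighted_wig hω l F).aemeasurable,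
    ← lintegral_const_mul' _ _ ENNReal.ofReal_ne_top]
  refine lintegral_mono fun x => ?_
  calc ENNReal.ofReal (Real.exp (l * ω ‖x‖)) * ‖F x‖ₑ ^ 2
      ≤ ENNReal.ofReal (Real.exp (l * ω ‖x‖)) *
          (ENNReal.ofReal |((2 * Real.pi) ^ N)⁻¹| * ∫⁻ ξ, ‖wig τ F (x, ξ)‖ₑ) := by
        gcongr
        exact enorm_sq_le_lintegral_wig hτ0 F x
    _ = ENNReal.ofReal |((2 * Real.pi) ^ N)⁻¹| *
          ∫⁻ ξ, ENNReal.ofReal (Real.exp (l * ω ‖x‖)) * ‖wig τ F (x, ξ)‖ₑ := by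
        rw [lintegral_const_mul' _ _ ENNReal.ofReal_ne_top, mul_left_comm]
    _ ≤ _ := by
        refine mul_le_mul_right (lintegral_mono fun ξ => ?_) _
        exact mul_le_mul' (hω.exp_le_exp hl (norm_nonneg _) (norm_fst_le_phaseNorm (x, ξ))) le_rfl

/-- The local bound is applied with `v` the `l`-weight in frequency and `r = b l` in space. The two
integrals it produces are each a multiple of the weighted `L¹` norm `M` of the Wigner transform, and
`M^(1-θ) * M^θ = M`. -/
theorem exists_weight_mul_fourierT_sq_le (hω : IsWeight ω) {b : ℝ} (hb : IsLogConst ω b)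
    (hτ0 : τ ≠ 0) {l L : ℝ} (hL : 0 ≤ L) (hLl : L < l) (hN : (N : ℝ) < b * (l - L)) :
    ∃ C : ℝ≥0∞, C ≠ ∞ ∧ ∀ (F : 𝓢(RN N, ℂ)) (ξ : RN N),
      ENNReal.ofReal (Real.exp (L * ω ‖ξ‖)) * ‖fourierT F ξ‖ₑ ^ 2 ≤
        C * ∫⁻ z, ENNReal.ofReal (Real.exp (l * ω (phaseNorm z))) * ‖wig τ F z‖ₑ := by
  have hl : 0 < l := hL.trans_lt hLl
  have hb0 := hb.1
  have hpi : 0 < 2 * Real.pi := by positivity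
  obtain ⟨C₁, hC₁⟩ := hω.exists_add_le hpi
  obtain ⟨C₂, hC₂0, hC₂⟩ := hb.exists_rpow_le hl.le
  set v : RN N → ℝ≥0∞ := fun η => ENNReal.ofReal (Real.exp (l * ω (2 * Real.pi * ‖η‖))) with hv
  -- Chosen so that `l (1 - θ) = L` gives the target weight, while `θ (b l) = b (l - L) > N`.
  set θ : ℝ := (l - L) / l with hθ
  have hθ0 : 0 ≤ θ := div_nonneg (by linarith) hl.le
  have hθ1 : θ ≤ 1 := by rw [hθ, div_le_one hl]; linarith
  have h1θ : 0 ≤ 1 - θ := by linarith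
  obtain ⟨C, hC, hmain⟩ := exists_weight_mul_fourier_sq_le (V := RN N) (v := v)
    (C₀ := ENNReal.ofReal (Real.exp (l * C₁))) ENNReal.ofReal_ne_top
    (fun ξ ξ₀ h => by
      rw [hv, ← ENNReal.ofReal_mul (Real.exp_pos _).le, ← Real.exp_add, ← mul_add]
      refine ENNReal.ofReal_le_ofReal (Real.exp_le_exp.2 (mul_le_mul_of_nonneg_left ?_ hl.le))
      have h1 : ‖ξ₀‖ ≤ ‖ξ‖ + 1 := by
        have := norm_sub_norm_le ξ₀ ξ
        rw [norm_sub_rev] at this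
        linarith
      have h2 : 2 * Real.pi * ‖ξ₀‖ ≤ 2 * Real.pi * ‖ξ‖ + 2 * Real.pi := by nlinarith
      have h3 := hω.monotoneOn (mem_Ici.2 (by positivity)) (mem_Ici.2 (by positivity)) h2
      linarith [hC₁ (2 * Real.pi * ‖ξ‖) (by positivity)])
    (fun ξ => ENNReal.ofReal_ne_top) (r := b * l) (θ := θ) (by positivity) hθ0 hθ1
    (by
      rw [finrank_euclideanSpace_fin, hθ]
      calc (N : ℝ) < b * (l - L) := hN
        _ = _ := by field_simp)
  set c := ENNReal.ofReal |((2 * Real.pi) ^ N)⁻¹| with hc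
  refine ⟨C * c ^ (1 - θ) * (ENNReal.ofReal C₂ * c) ^ θ, ?_, fun F ξ => ?_⟩
  · exact ENNReal.mul_ne_top (ENNReal.mul_ne_top hC
      (ENNReal.rpow_ne_top_of_nonneg h1θ ENNReal.ofReal_ne_top))
      (ENNReal.rpow_ne_top_of_nonneg hθ0
        (ENNReal.mul_ne_top ENNReal.ofReal_ne_top ENNReal.ofReal_ne_top))
  have h := hmain F ((2 * Real.pi)⁻¹ • ξ)
  set M := ∫⁻ z, ENNReal.ofReal (Real.exp (l * ω (phaseNorm z))) * ‖wig τ F z‖ₑ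
  have hP : ∫⁻ η, v η * ‖𝓕 F η‖ₑ ^ 2 ≤ c * M := by
    have e := lintegral_comp_smul volume
      (fun ξ : RN N => ENNReal.ofReal (Real.exp (l * ω ‖ξ‖)) * ‖fourierT F ξ‖ₑ ^ 2) hpi.ne'
    rw [finrank_euclideanSpace_fin] at e
    refine le_trans (le_of_eq ((lintegral_congr fun η => ?_).trans e))
      (mul_le_mul' le_rfl (lintegral_weight_fourierT_sq_le hω hl.le F))
    rw [SchwartzMap.fourier_coe, fourier_eq_fourierT, norm_smul, Real.norm_of_nonneg hpi.le]
  have hQ : ∫⁻ x, ENNReal.ofReal ((1 + ‖x‖) ^ (b * l)) * ‖F x‖ₑ ^ 2 ≤ ENNReal.ofReal C₂ * c * M := by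
    calc ∫⁻ x, ENNReal.ofReal ((1 + ‖x‖) ^ (b * l)) * ‖F x‖ₑ ^ 2
        ≤ ∫⁻ x, ENNReal.ofReal C₂ * (ENNReal.ofReal (Real.exp (l * ω ‖x‖)) * ‖F x‖ₑ ^ 2) := by
          refine lintegral_mono fun x => ?_
          rw [← mul_assoc, ← ENNReal.ofReal_mul hC₂0.le]
          gcongr
          exact hC₂ _ (norm_nonneg x)
      _ ≤ _ := by
          rw [lintegral_const_mul' _ _ ENNReal.ofReal_ne_top, mul_assoc]
          gcongr
          exact lintegral_weight_sq_le hω hτ0 hl.le F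
  have hvξ : v ((2 * Real.pi)⁻¹ • ξ) ^ (1 - θ) = ENNReal.ofReal (Real.exp (L * ω ‖ξ‖)) := by
    rw [hv, ENNReal.ofReal_rpow_of_pos (Real.exp_pos _), ← Real.exp_mul]
    congr 2
    rw [norm_smul, Real.norm_of_nonneg (by positivity), mul_inv_cancel_left₀ hpi.ne', hθ]
    field_simp
    ring
  rw [hvξ, SchwartzMap.fourier_coe, ← fourierT_eq] at h
  refine h.trans ?_
  calc C * (∫⁻ η, v η * ‖𝓕 F η‖ₑ ^ 2) ^ (1 - θ) *
        (∫⁻ x, ENNReal.ofReal ((1 + ‖x‖) ^ (b * l)) * ‖F x‖ₑ ^ 2) ^ θ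
      ≤ C * (c * M) ^ (1 - θ) * (ENNReal.ofReal C₂ * c * M) ^ θ := by gcongr
    _ = C * c ^ (1 - θ) * (ENNReal.ofReal C₂ * c) ^ θ * (M ^ (1 - θ) * M ^ θ) := by
        rw [ENNReal.mul_rpow_of_nonneg _ M h1θ, ENNReal.mul_rpow_of_nonneg _ M hθ0]
        ring
    _ = _ := by
        rw [← ENNReal.rpow_add_of_nonneg _ _ h1θ hθ0, sub_add_cancel, ENNReal.rpow_one]

theorem enorm_exp_mul (s : ℝ) (w : ℂ) :
    ‖(Real.exp s : ℂ) * w‖ₑ = ENNReal.ofReal (Real.exp s) * ‖w‖ₑ := by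
  rw [enorm_mul, ← ofReal_norm (Real.exp s : ℂ), Complex.norm_real,
    Real.norm_of_nonneg (Real.exp_pos s).le]

theorem setLIntegral_fourierT_le (hN : 0 < N) (hω : IsWeight ω) {b : ℝ} (hb : IsLogConst ω b)
    (hτ0 : τ ≠ 0) {α l lam mu : ℝ} (hα : (N : ℝ) < α) (hlam : 0 ≤ lam) (hmu : 0 ≤ mu)
    (hl : 2 * (lam + mu) < l) (hNl : (N : ℝ) < b * (l - 2 * (lam + mu))) :
    ∃ C : ℝ, 0 < C ∧ ∀ (E : Set (RN N)) (zbar : RN N × RN N) (f : RN N → ℂ), MemSω ω f →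
      ∫⁻ ξ in E, ENNReal.ofReal (Real.exp (2 * lam * ω ‖ξ‖) * ‖fourierT f ξ‖ ^ 2) ≤
        ENNReal.ofReal C
          * (∫⁻ ξ in E, ENNReal.ofReal (Real.exp (-(2 * mu * ω ‖ξ‖))))
          * eLpNorm (fun z : RN N × RN N =>
              (Real.exp (l * ω (phaseNorm z)) : ℂ) * wig τ f z) 2 volume ^ (1 - (N : ℝ) / α)
          * eLpNorm (fun z : RN N × RN N =>
              ((phaseNorm (z - zbar) ^ α : ℝ) : ℂ) *
                ((Real.exp (l * ω (phaseNorm z)) : ℂ) * wig τ f z)) 2 volume ^ ((N : ℝ) / α) := by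
  have hN' : (0 : ℝ) < N := by exact_mod_cast hN
  have hα0 : 0 < α := hN'.trans hα
  have : Nontrivial (RN N) := by
    have : Nonempty (Fin N) := ⟨⟨0, hN⟩⟩
    infer_instance
  have : (volume : Measure (RN N × RN N)).IsAddHaarMeasure := Measure.prod.instIsAddHaarMeasure _ _
  have hfr : (Module.finrank ℝ (RN N × RN N) : ℝ) = 2 * N := by
    rw [Module.finrank_prod, finrank_euclideanSpace_fin]
    push_cast
    ring
  obtain ⟨C₁, hC₁, h1⟩ := exists_weight_mul_fourierT_sq_le (τ := τ) hω hb hτ0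
    (by positivity : 0 ≤ 2 * (lam + mu)) hl hNl
  obtain ⟨C₂, hC₂, h2⟩ := exists_lintegral_enorm_le (volume : Measure (RN N × RN N)) (α := α)
    (by rw [hfr]; linarith)
  rw [hfr, mul_div_mul_left _ _ two_ne_zero] at h2
  refine ⟨(C₁ * C₂).toReal + 1, by positivity, fun E zbar f hf => ?_⟩
  obtain ⟨F, hF⟩ := exists_schwartzMap hb hf
  obtain rfl : ⇑F = f := funext hF
  set D := ∫⁻ ξ in E, ENNReal.ofReal (Real.exp (-(2 * mu * ω ‖ξ‖)))
  set g : RN N × RN N → ℂ := fun z => (Real.exp (l * ω (phaseNorm z)) : ℂ) * wig τ F z with hg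
  have hgm : AEStronglyMeasurable g volume :=
    ((Complex.measurable_ofReal.comp (Real.continuous_exp.comp (continuous_const.mul
      (hω.continuous_comp continuous_phaseNorm phaseNorm_nonneg))).measurable).mul
        (measurable_wig F)).aestronglyMeasurable
  set M := ∫⁻ z, ‖g z‖ₑ with hM
  have hMg : M = ∫⁻ z, ENNReal.ofReal (Real.exp (l * ω (phaseNorm z))) * ‖wig τ F z‖ₑ :=
    lintegral_congr fun z => enorm_exp_mul _ _
  -- The rate `L = 2 (lam + mu)` leaves the factor `exp (-2 mu ω)` to be integrated over `E`.
  have hpt : ∀ ξ : RN N, ENNReal.ofReal (Real.exp (2 * lam * ω ‖ξ‖) * ‖fourierT F ξ‖ ^ 2) ≤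
      ENNReal.ofReal (Real.exp (-(2 * mu * ω ‖ξ‖))) * (C₁ * M) := fun ξ => by
    rw [hMg]
    refine le_trans (le_of_eq ?_) (mul_le_mul_right (h1 F ξ) _)
    rw [← mul_assoc, ← ENNReal.ofReal_mul (Real.exp_pos _).le, ← Real.exp_add,
      ENNReal.ofReal_mul (Real.exp_pos _).le, ENNReal.ofReal_pow (norm_nonneg _), ofReal_norm]
    ring_nf
  -- The interpolation lemma uses the sup norm of the product, which the Euclidean norm dominates.
  have hB : eLpNorm (fun z => ((‖z - zbar‖ ^ α : ℝ) : ℂ) * g z) 2 volume ≤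
      eLpNorm (fun z => ((phaseNorm (z - zbar) ^ α : ℝ) : ℂ) * g z) 2 volume := by
    refine eLpNorm_mono fun z => ?_
    rw [norm_mul, norm_mul _ (g z), Complex.norm_real, Complex.norm_real,
      Real.norm_of_nonneg (by positivity),
      Real.norm_of_nonneg (Real.rpow_nonneg (phaseNorm_nonneg _) _)]
    gcongr
    exact norm_le_phaseNorm _
  calc ∫⁻ ξ in E, ENNReal.ofReal (Real.exp (2 * lam * ω ‖ξ‖) * ‖fourierT F ξ‖ ^ 2)
      ≤ ∫⁻ ξ in E, ENNReal.ofReal (Real.exp (-(2 * mu * ω ‖ξ‖))) * (C₁ * M) :=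
        lintegral_mono hpt
    _ = D * (C₁ * M) := by
        refine lintegral_mul_const _ ?_
        simpa only [neg_mul] using
          hω.measurable_exp (-(2 * mu)) (continuous_norm (E := RN N)) norm_nonneg
    _ ≤ D * (C₁ * (C₂ * eLpNorm g 2 volume ^ (1 - (N : ℝ) / α) *
          eLpNorm (fun z => ((phaseNorm (z - zbar) ^ α : ℝ) : ℂ) * g z) 2 volume ^
            ((N : ℝ) / α))) := by
        gcongr
        exact (h2 g hgm zbar).trans (by gcongr)
    _ = (C₁ * C₂) * D * eLpNorm g 2 volume ^ (1 - (N : ℝ) / α) *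
          eLpNorm (fun z => ((phaseNorm (z - zbar) ^ α : ℝ) : ℂ) * g z) 2 volume ^
            ((N : ℝ) / α) := by ring
    _ ≤ _ := by
        gcongr
        exact (ENNReal.ofReal_toReal (ENNReal.mul_ne_top hC₁ hC₂)).symm.le.trans
          (ENNReal.ofReal_le_ofReal (by linarith))

end Marginals

/-! ### Pointwise bounds on the Wigner transform by `L¹` norms of `f` and `f̂`. -/

section PointwiseBound

open FourierTransform
open scoped SchwartzMap ComplexConjugate

variable {N : ℕ} {τ : ℝ} {ω : ℝ → ℝ}

/-- The common mechanism for `x` and `ξ`: the weight goes to one factor at a time, the other factor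
is replaced by its supremum `S`, and `c₁`, `c₂` are the Jacobians of the two changes of variable. -/
theorem mul_lintegral_le_of_le_add {X : Type*} [MeasurableSpace X] {μ : Measure X}
    {w p : X → ℝ≥0∞} {u v : X → X} {c₁ c₂ S W : ℝ≥0∞} (hWt : W ≠ ∞) (hS : ∀ x, p x ≤ S)
    (hW : ∀ t, W ≤ w (u t) + w (v t)) (hum : Measurable fun t => w (u t) * p (u t))
    (hvm : Measurable fun t => w (v t) * p (v t))
    (hu : ∫⁻ t, w (u t) * p (u t) ∂μ = c₁ * ∫⁻ x, w x * p x ∂μ)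
    (hv : ∫⁻ t, w (v t) * p (v t) ∂μ = c₂ * ∫⁻ x, w x * p x ∂μ) :
    W * ∫⁻ t, p (u t) * p (v t) ∂μ ≤ (c₁ + c₂) * S * ∫⁻ x, w x * p x ∂μ := by
  calc W * ∫⁻ t, p (u t) * p (v t) ∂μ = ∫⁻ t, W * (p (u t) * p (v t)) ∂μ :=
        (lintegral_const_mul' _ _ hWt).symm
    _ ≤ ∫⁻ t, (w (u t) * p (u t) * S + w (v t) * p (v t) * S) ∂μ := by
        refine lintegral_mono fun t => ?_
        calc W * (p (u t) * p (v t)) ≤ (w (u t) + w (v t)) * (p (u t) * p (v t)) :=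
              mul_le_mul' (hW t) le_rfl
          _ = w (u t) * p (u t) * p (v t) + w (v t) * p (v t) * p (u t) := by ring
          _ ≤ _ := add_le_add (mul_le_mul' le_rfl (hS _)) (mul_le_mul' le_rfl (hS _))
    _ = _ := by
        rw [lintegral_add_left (hum.mul_const S), lintegral_mul_const _ hum,
          lintegral_mul_const _ hvm, hu, hv]
        ring

theorem lintegral_comp_add_smul (f : RN N → ℝ≥0∞) (x : RN N) {r : ℝ} (hr : r ≠ 0) :
    ∫⁻ t, f (x + r • t) = ENNReal.ofReal |(r ^ N)⁻¹| * ∫⁻ t, f t := by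
  have h := lintegral_comp_smul volume (fun t => f (x + t)) hr
  rw [finrank_euclideanSpace_fin, lintegral_add_left_eq_self] at h
  exact h

theorem IsWeight.exp_le_add (hω : IsWeight ω) {l q s t : ℝ} (hl : 0 ≤ l) (hq : 0 ≤ q)
    (h : q ≤ max s t) : ENNReal.ofReal (Real.exp (l * ω q)) ≤
      ENNReal.ofReal (Real.exp (l * ω s)) + ENNReal.ofReal (Real.exp (l * ω t)) := by
  rcases le_max_iff.1 h with h | h
  · exact (hω.exp_le_exp hl hq h).trans le_self_add
  · exact (hω.exp_le_exp hl hq h).trans le_add_self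

theorem norm_convex_comb_le (hτ : τ ∈ Ioo (0 : ℝ) 1) (a b : RN N) :
    ‖τ • a + (1 - τ) • b‖ ≤ max ‖a‖ ‖b‖ := by
  have h1 : 0 < 1 - τ := by linarith [hτ.2]
  refine (norm_add_le _ _).trans ?_
  rw [norm_smul, norm_smul, Real.norm_of_nonneg hτ.1.le, Real.norm_of_nonneg h1.le]
  nlinarith [le_max_left ‖a‖ ‖b‖, le_max_right ‖a‖ ‖b‖, hτ.1]

theorem enorm_fourier_le (F : 𝓢(RN N, ℂ)) (η : RN N) : ‖𝓕 F η‖ₑ ≤ ∫⁻ x, ‖F x‖ₑ := by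
  rw [SchwartzMap.fourier_coe, Real.fourier_eq]
  refine (enorm_integral_le_lintegral_enorm _).trans_eq (lintegral_congr fun x => ?_)
  rw [← ofReal_norm, Circle.norm_smul, ofReal_norm]

theorem eq_integral_fourier (F : 𝓢(RN N, ℂ)) (x : RN N) :
    F x = ∫ η, Complex.exp (((2 * Real.pi * inner ℝ η x : ℝ) : ℂ) * Complex.I) * 𝓕 F η := by
  have h : (𝓕⁻ (𝓕 F)) x = F x := by rw [FourierTransform.fourierInv_fourier_eq]
  rw [← h, SchwartzMap.fourierInv_coe, Real.fourierInv_eq']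
  rfl

theorem enorm_le_lintegral_fourier (F : 𝓢(RN N, ℂ)) (x : RN N) :
    ‖F x‖ₑ ≤ ∫⁻ η, ‖𝓕 F η‖ₑ := by
  rw [eq_integral_fourier]
  refine (enorm_integral_le_lintegral_enorm _).trans_eq (lintegral_congr fun η => ?_)
  rw [← ofReal_norm, norm_mul, Complex.norm_exp_ofReal_mul_I, one_mul, ofReal_norm]

theorem weight_fst_mul_wig_le (hω : IsWeight ω) (hτ : τ ∈ Ioo (0 : ℝ) 1) {l : ℝ} (hl : 0 ≤ l)
    (F : 𝓢(RN N, ℂ)) (x ξ : RN N) :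
    ENNReal.ofReal (Real.exp (l * ω ‖x‖)) * ‖wig τ F (x, ξ)‖ₑ ≤
      (ENNReal.ofReal |(τ ^ N)⁻¹| + ENNReal.ofReal |((-(1 - τ)) ^ N)⁻¹|) * (∫⁻ η, ‖𝓕 F η‖ₑ) *
        ∫⁻ y : RN N, ENNReal.ofReal (Real.exp (l * ω ‖y‖)) * ‖F y‖ₑ := by
  have h1 : -(1 - τ) ≠ 0 := by linarith [hτ.2]
  have hm : Measurable fun y : RN N => ENNReal.ofReal (Real.exp (l * ω ‖y‖)) * ‖F y‖ₑ :=
    (hω.measurable_exp l continuous_norm norm_nonneg).mul F.continuous.measurable.enorm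
  have hw : ‖wig τ F (x, ξ)‖ₑ ≤ ∫⁻ t, ‖F (x + τ • t)‖ₑ * ‖F (x + (-(1 - τ)) • t)‖ₑ := by
    refine (enorm_integral_le_lintegral_enorm _).trans_eq (lintegral_congr fun t => ?_)
    rw [enorm_mul, enorm_mul, ← ofReal_norm (Complex.exp _), norm_exp_neg_I_mul,
      ENNReal.ofReal_one, one_mul, ← ofReal_norm (conj _), RCLike.norm_conj, ofReal_norm, neg_smul,
      ← sub_eq_add_neg]
  refine (mul_le_mul' le_rfl hw).trans ?_
  refine mul_lintegral_le_of_le_add (w := fun y => ENNReal.ofReal (Real.exp (l * ω ‖y‖)))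
    (p := fun y => ‖F y‖ₑ) (u := fun t => x + τ • t) (v := fun t => x + (-(1 - τ)) • t)
    ENNReal.ofReal_ne_top (enorm_le_lintegral_fourier F) (fun t => ?_)
    (hm.comp (by fun_prop : Measurable fun t : RN N => x + τ • t))
    (hm.comp (by fun_prop : Measurable fun t : RN N => x + (-(1 - τ)) • t))
    (lintegral_comp_add_smul
      (fun y => ENNReal.ofReal (Real.exp (l * ω ‖y‖)) * ‖F y‖ₑ) x hτ.1.ne')
    (lintegral_comp_add_smul (fun y => ENNReal.ofReal (Real.exp (l * ω ‖y‖)) * ‖F y‖ₑ) x h1)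
  refine hω.exp_le_add hl (norm_nonneg _) ?_
  have h2 := norm_convex_comb_le hτ (x + (-(1 - τ)) • t) (x + τ • t)
  -- The fixed point `x` is a convex combination of the two arguments of `F`, for every `t`.
  rw [show τ • (x + (-(1 - τ)) • t) + (1 - τ) • (x + τ • t) = x by module, max_comm] at h2
  exact h2

/-- The `τ`-Wigner transform bounded through the Fourier transform of the function. -/
theorem enorm_wig_le_lintegral_fourier (hτ0 : τ ≠ 0) (F : 𝓢(RN N, ℂ)) (x ξ : RN N) :
    ‖wig τ F (x, ξ)‖ₑ ≤ ENNReal.ofReal |(τ ^ N)⁻¹| *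
      ∫⁻ η, ‖𝓕 F η‖ₑ * ‖𝓕 F ((2 * Real.pi * τ)⁻¹ • ξ + (-((1 - τ) / τ)) • η)‖ₑ := by
  set κ : RN N → RN N := fun η => (2 * Real.pi * τ)⁻¹ • ξ + (-((1 - τ) / τ)) • η with hκ
  set k : RN N → RN N → ℂ := fun t η =>
    (Complex.exp (-(Complex.I * ((inner ℝ t ξ : ℝ) : ℂ))) *
      Complex.exp (-(Complex.I * ((2 * Real.pi * inner ℝ η (x - (1 - τ) • t) : ℝ) : ℂ)))) *
      (F (x + τ • t) * conj (𝓕 F η)) with hk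
  -- Fourier inversion is applied to the conjugated factor only; the remaining `t`-integral is then
  -- a Fourier transform of `F` up to a phase and a dilation.
  have hwig : wig τ F (x, ξ) = ∫ t, ∫ η, k t η := by
    refine integral_congr_ae (ae_of_all _ fun t => ?_)
    simp only [hk]
    rw [eq_integral_fourier F (x - (1 - τ) • t), ← integral_conj, ← integral_const_mul,
      ← integral_const_mul]
    refine integral_congr_ae (ae_of_all _ fun η => ?_)
    simp only [map_mul, ← Complex.exp_conj, Complex.conj_ofReal, Complex.conj_I]
    rw [show (((2 * Real.pi * inner ℝ η (x - (1 - τ) • t) : ℝ) : ℂ)) * -Complex.I =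
      -(Complex.I * ((2 * Real.pi * inner ℝ η (x - (1 - τ) • t) : ℝ) : ℂ)) by ring]
    ring
  have hint : Integrable (Function.uncurry k) (volume.prod volume) := by
    have h1 : Integrable fun t => F (x + τ • t) := (F.integrable.comp_add_left x).comp_smul hτ0
    have h2 : Integrable fun η => conj (𝓕 F η) :=
      (Complex.conjCLE : ℂ →L[ℝ] ℂ).integrable_comp ((𝓕 F).integrable (μ := volume))
    refine (h1.mul_prod h2).bdd_mul (c := 1) ?_ (ae_of_all _ fun p => ?_)
    · exact Continuous.aestronglyMeasurable (by fun_prop)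
    · rw [norm_mul, norm_exp_neg_I_mul, norm_exp_neg_I_mul, one_mul]
  have hinner : ∀ η, ‖∫ t, k t η‖ₑ =
      ENNReal.ofReal |(τ ^ N)⁻¹| * (‖𝓕 F η‖ₑ * ‖𝓕 F (κ η)‖ₑ) := fun η => by
    set Φ : RN N → ℂ := fun y =>
      Complex.exp (((-2 * Real.pi * inner ℝ y (κ η) : ℝ) : ℂ) * Complex.I) • F y with hΦ
    have e1 : ∀ t, k t η = Complex.exp
        (((inner ℝ x ξ / τ - 2 * Real.pi * inner ℝ η x / τ : ℝ) : ℂ) * Complex.I) *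
          conj (𝓕 F η) * Φ (x + τ • t) := fun t => by
      have e2 : (-(Complex.I * ((inner ℝ t ξ : ℝ) : ℂ))) +
          (-(Complex.I * ((2 * Real.pi * inner ℝ η (x - (1 - τ) • t) : ℝ) : ℂ))) =
          ((inner ℝ x ξ / τ - 2 * Real.pi * inner ℝ η x / τ : ℝ) : ℂ) * Complex.I +
          ((-2 * Real.pi * inner ℝ (x + τ • t) (κ η) : ℝ) : ℂ) * Complex.I := by
        rw [← add_mul, ← mul_neg, ← mul_neg, ← mul_add, mul_comm]
        congr 1
        rw [← Complex.ofReal_neg, ← Complex.ofReal_neg, ← Complex.ofReal_add,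
          ← Complex.ofReal_add]
        congr 1
        simp only [hκ, inner_add_left, inner_add_right, inner_sub_right, real_inner_smul_left,
          real_inner_smul_right, real_inner_comm x η, real_inner_comm t η]
        field_simp
        ring
      simp only [hk, hΦ, smul_eq_mul]
      rw [← Complex.exp_add, e2, Complex.exp_add]
      ring
    simp_rw [e1]
    have e3 : ∫ t, Φ (x + τ • t) = |(τ ^ N)⁻¹| • 𝓕 F (κ η) := by
      have e4 := Measure.integral_comp_smul volume (fun t => Φ (x + t)) τ
      rw [finrank_euclideanSpace_fin, integral_add_left_eq_self] at e4
      rw [e4, SchwartzMap.fourier_coe, Real.fourier_eq']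
    rw [integral_const_mul, e3, enorm_mul, enorm_mul, enorm_smul, ← ofReal_norm (Complex.exp _),
      Complex.norm_exp_ofReal_mul_I, ENNReal.ofReal_one, one_mul, ← ofReal_norm (conj _),
      RCLike.norm_conj, ofReal_norm, ← ofReal_norm |(τ ^ N)⁻¹|, Real.norm_eq_abs, abs_abs]
    ring
  rw [hwig, integral_integral_swap hint]
  refine (enorm_integral_le_lintegral_enorm _).trans_eq ?_
  simp_rw [hinner]
  rw [lintegral_const_mul' _ _ ENNReal.ofReal_ne_top]

theorem weight_snd_mul_wig_le (hω : IsWeight ω) (hτ : τ ∈ Ioo (0 : ℝ) 1) {l : ℝ} (hl : 0 ≤ l)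
    (F : 𝓢(RN N, ℂ)) (x ξ : RN N) :
    ENNReal.ofReal (Real.exp (l * ω ‖ξ‖)) * ‖wig τ F (x, ξ)‖ₑ ≤
      ENNReal.ofReal |(τ ^ N)⁻¹| * ((1 + ENNReal.ofReal |((-((1 - τ) / τ)) ^ N)⁻¹|) *
        (∫⁻ y, ‖F y‖ₑ) *
        ∫⁻ η : RN N, ENNReal.ofReal (Real.exp (l * ω ‖(2 * Real.pi) • η‖)) * ‖𝓕 F η‖ₑ) := by
  have hτ0 : τ ≠ 0 := hτ.1.ne'
  have h1 : -((1 - τ) / τ) ≠ 0 := neg_ne_zero.2 (div_pos (by linarith [hτ.2]) hτ.1).ne'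
  have hm : Measurable fun η : RN N =>
      ENNReal.ofReal (Real.exp (l * ω ‖(2 * Real.pi) • η‖)) * ‖𝓕 F η‖ₑ :=
    (hω.measurable_exp l (by fun_prop) fun _ => norm_nonneg _).mul
      (𝓕 F).continuous.measurable.enorm
  refine (mul_le_mul' le_rfl (enorm_wig_le_lintegral_fourier hτ0 F x ξ)).trans ?_
  rw [mul_left_comm]
  refine mul_le_mul' le_rfl (mul_lintegral_le_of_le_add
    (w := fun η => ENNReal.ofReal (Real.exp (l * ω ‖(2 * Real.pi) • η‖)))
    (p := fun η => ‖𝓕 F η‖ₑ) (u := fun η => η)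
    (v := fun η => (2 * Real.pi * τ)⁻¹ • ξ + (-((1 - τ) / τ)) • η)
    ENNReal.ofReal_ne_top (enorm_fourier_le F) (fun η => ?_) hm
    (hm.comp (by fun_prop : Measurable fun η : RN N =>
      (2 * Real.pi * τ)⁻¹ • ξ + (-((1 - τ) / τ)) • η))
    (one_mul _).symm (lintegral_comp_add_smul (fun η =>
      ENNReal.ofReal (Real.exp (l * ω ‖(2 * Real.pi) • η‖)) * ‖𝓕 F η‖ₑ) _ h1))
  refine hω.exp_le_add hl (norm_nonneg _) ?_
  have h2 := norm_convex_comb_le hτ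
    ((2 * Real.pi) • ((2 * Real.pi * τ)⁻¹ • ξ + (-((1 - τ) / τ)) • η)) ((2 * Real.pi) • η)
  -- In rescaled frequencies, `ξ` is again a convex combination of the two arguments of `𝓕 F`, for
  -- every `η`.
  rw [show τ • ((2 * Real.pi) • ((2 * Real.pi * τ)⁻¹ • ξ + (-((1 - τ) / τ)) • η)) +
    (1 - τ) • ((2 * Real.pi) • η) = ξ by
      have hpi : (2 * Real.pi) ≠ 0 := by positivity
      rw [smul_add, smul_add, smul_smul, smul_smul, smul_smul, smul_smul, smul_smul, add_assoc,
        ← add_smul]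
      rw [show τ * (2 * Real.pi) * (2 * Real.pi * τ)⁻¹ = 1 by field_simp,
        show τ * (2 * Real.pi) * -((1 - τ) / τ) + (1 - τ) * (2 * Real.pi) = 0 by field_simp; ring,
        one_smul, zero_smul, add_zero], max_comm] at h2
  exact h2

end PointwiseBound

section PointwiseBound

open FourierTransform
open scoped SchwartzMap ComplexConjugate

variable {N : ℕ} {τ : ℝ} {ω : ℝ → ℝ}

theorem lintegral_fourier_eq (w : RN N → ℝ≥0∞) (F : 𝓢(RN N, ℂ)) :
    ∫⁻ η, w ((2 * Real.pi) • η) * ‖𝓕 F η‖ₑ =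
      ENNReal.ofReal |((2 * Real.pi) ^ N)⁻¹| * ∫⁻ ξ, w ξ * ‖fourierT F ξ‖ₑ := by
  have e := lintegral_comp_smul volume (fun ξ : RN N => w ξ * ‖fourierT F ξ‖ₑ)
    (show (2 * Real.pi : ℝ) ≠ 0 by positivity)
  rw [finrank_euclideanSpace_fin] at e
  rw [← e]
  refine lintegral_congr fun η => ?_
  rw [SchwartzMap.fourier_coe, fourier_eq_fourierT]

theorem IsWeight.le_exp_mul (hω : IsWeight ω) {l t : ℝ} (hl : 0 ≤ l) (ht : 0 ≤ t) (a : ℝ≥0∞) :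
    a ≤ ENNReal.ofReal (Real.exp (l * ω t)) * a := by
  refine le_mul_of_one_le_left zero_le ?_
  rw [← ENNReal.ofReal_one]
  exact ENNReal.ofReal_le_ofReal (Real.one_le_exp (mul_nonneg hl (hω.nonneg t ht)))

/-- Since `|z| ≤ 2 max(|x|, |ξ|)`, one use of doubling multiplies the rate by `K` and costs the
constant `exp (K ν)`. -/
theorem IsWeight.exp_phaseNorm_le (hω : IsWeight ω) {K : ℝ} (hK : IsDoublingConst ω K)
    {ν l : ℝ} (hν : 0 ≤ ν) (hl : K * ν ≤ l) (z : RN N × RN N) :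
    ENNReal.ofReal (Real.exp (ν * ω (phaseNorm z))) ≤ ENNReal.ofReal (Real.exp (K * ν)) *
      (ENNReal.ofReal (Real.exp (l * ω ‖z.1‖)) + ENNReal.ofReal (Real.exp (l * ω ‖z.2‖))) := by
  have hK0 : 0 ≤ K := zero_le_one.trans hK.1
  have hm : 0 ≤ max ‖z.1‖ ‖z.2‖ := le_max_of_le_left (norm_nonneg _)
  have hl0 : 0 ≤ l := (mul_nonneg hK0 hν).trans hl
  refine le_trans ?_ (mul_le_mul' le_rfl (hω.exp_le_add hl0 hm le_rfl))
  rw [← ENNReal.ofReal_mul (Real.exp_pos _).le, ← Real.exp_add]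
  refine ENNReal.ofReal_le_ofReal (Real.exp_le_exp.2 ?_)
  have h1 := hω.monotoneOn (phaseNorm_nonneg z) (mem_Ici.2 (by positivity)) (phaseNorm_le z)
  have h2 := h1.trans (hK.2 _ hm)
  nlinarith [mul_le_mul_of_nonneg_left h2 hν, mul_le_mul_of_nonneg_right hl (hω.nonneg _ hm)]

theorem exists_weight_mul_wig_le (hω : IsWeight ω) {K : ℝ} (hK : IsDoublingConst ω K)
    (hτ : τ ∈ Ioo (0 : ℝ) 1) {ν l : ℝ} (hν : 0 ≤ ν) (hl : K * ν ≤ l) :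
    ∃ C : ℝ≥0∞, C ≠ ∞ ∧ ∀ (F : 𝓢(RN N, ℂ)) (z : RN N × RN N),
      ENNReal.ofReal (Real.exp (ν * ω (phaseNorm z))) * ‖wig τ F z‖ₑ ≤
        C * ((∫⁻ x : RN N, ENNReal.ofReal (Real.exp (l * ω ‖x‖)) * ‖F x‖ₑ) *
          ∫⁻ ξ : RN N, ENNReal.ofReal (Real.exp (l * ω ‖ξ‖)) * ‖fourierT F ξ‖ₑ) := by
  have hK0 : 0 ≤ K := zero_le_one.trans hK.1
  have hl0 : 0 ≤ l := (mul_nonneg hK0 hν).trans hl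
  set c := ENNReal.ofReal |((2 * Real.pi) ^ N)⁻¹| with hc
  set a := ENNReal.ofReal |(τ ^ N)⁻¹| + ENNReal.ofReal |((-(1 - τ)) ^ N)⁻¹| with ha
  set d := ENNReal.ofReal |(τ ^ N)⁻¹| * (1 + ENNReal.ofReal |((-((1 - τ) / τ)) ^ N)⁻¹|) with hd
  refine ⟨ENNReal.ofReal (Real.exp (K * ν)) * (c * (a + d)), ?_, fun F z => ?_⟩
  · refine ENNReal.mul_ne_top ENNReal.ofReal_ne_top (ENNReal.mul_ne_top ENNReal.ofReal_ne_top
      (ENNReal.add_ne_top.2 ⟨?_, ENNReal.mul_ne_top ENNReal.ofReal_ne_top ?_⟩)) <;> simp [ha]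
  set A := ∫⁻ x : RN N, ENNReal.ofReal (Real.exp (l * ω ‖x‖)) * ‖F x‖ₑ with hA
  set B := ∫⁻ ξ : RN N, ENNReal.ofReal (Real.exp (l * ω ‖ξ‖)) * ‖fourierT F ξ‖ₑ with hB
  have hFA : ∫⁻ y, ‖F y‖ₑ ≤ A := lintegral_mono fun y => hω.le_exp_mul hl0 (norm_nonneg y) _
  have hFB : ∫⁻ η : RN N, ENNReal.ofReal (Real.exp (l * ω ‖(2 * Real.pi) • η‖)) * ‖𝓕 F η‖ₑ =
      c * B := lintegral_fourier_eq (fun ξ => ENNReal.ofReal (Real.exp (l * ω ‖ξ‖))) F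
  have hFB' : ∫⁻ η, ‖𝓕 F η‖ₑ ≤ c * B :=
    hFB ▸ lintegral_mono fun η => hω.le_exp_mul hl0 (norm_nonneg ((2 * Real.pi) • η)) _
  calc ENNReal.ofReal (Real.exp (ν * ω (phaseNorm z))) * ‖wig τ F z‖ₑ
      ≤ ENNReal.ofReal (Real.exp (K * ν)) * (ENNReal.ofReal (Real.exp (l * ω ‖z.1‖)) +
          ENNReal.ofReal (Real.exp (l * ω ‖z.2‖))) * ‖wig τ F z‖ₑ :=
        mul_le_mul' (hω.exp_phaseNorm_le hK hν hl z) le_rfl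
    _ = ENNReal.ofReal (Real.exp (K * ν)) * (ENNReal.ofReal (Real.exp (l * ω ‖z.1‖)) *
          ‖wig τ F (z.1, z.2)‖ₑ + ENNReal.ofReal (Real.exp (l * ω ‖z.2‖)) *
          ‖wig τ F (z.1, z.2)‖ₑ) := by ring
    _ ≤ ENNReal.ofReal (Real.exp (K * ν)) * (a * (c * B) * A +
          ENNReal.ofReal |(τ ^ N)⁻¹| *
            ((1 + ENNReal.ofReal |((-((1 - τ) / τ)) ^ N)⁻¹|) * A * (c * B))) := by
        refine mul_le_mul' le_rfl (add_le_add ?_ ?_)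
        · exact (weight_fst_mul_wig_le hω hτ hl0 F z.1 z.2).trans
            (mul_le_mul' (mul_le_mul' le_rfl hFB') le_rfl)
        · refine (weight_snd_mul_wig_le hω hτ hl0 F z.1 z.2).trans ?_
          rw [hFB]
          gcongr
    _ = _ := by
        rw [hd]
        ring

theorem setLIntegral_wig_le (hN : 0 < N) (hω : IsWeight ω) {K b : ℝ} (hK : IsDoublingConst ω K)
    (hb : IsLogConst ω b) (hτ : τ ∈ Ioo (0 : ℝ) 1) {α l lam mu : ℝ} (hα : (N : ℝ) / 2 < α)
    (hlam : 0 ≤ lam) (hmu : 0 ≤ mu) (hl : K * (lam + mu) ≤ l) :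
    ∃ C : ℝ, 0 < C ∧ ∀ (E : Set (RN N × RN N)) (xbar ξbar : RN N) (f : RN N → ℂ), MemSω ω f →
      ∫⁻ z in E, ENNReal.ofReal (Real.exp (lam * ω (phaseNorm z)) * ‖wig τ f z‖) ≤
        ENNReal.ofReal C
          * (∫⁻ z in E, ENNReal.ofReal (Real.exp (-(mu * ω (phaseNorm z)))))
          * eLpNorm (fun x : RN N => (Real.exp (l * ω ‖x‖) : ℂ) * f x)
              2 volume ^ (1 - (N : ℝ) / (2 * α))
          * eLpNorm (fun x : RN N =>
              (Real.exp (l * ω ‖x‖) : ℂ) * (((‖x - xbar‖ ^ α : ℝ) : ℂ) * f x))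
              2 volume ^ ((N : ℝ) / (2 * α))
          * eLpNorm (fun ξ : RN N => (Real.exp (l * ω ‖ξ‖) : ℂ) * fourierT f ξ)
              2 volume ^ (1 - (N : ℝ) / (2 * α))
          * eLpNorm (fun ξ : RN N =>
              (Real.exp (l * ω ‖ξ‖) : ℂ) * (((‖ξ - ξbar‖ ^ α : ℝ) : ℂ) * fourierT f ξ))
              2 volume ^ ((N : ℝ) / (2 * α)) := by
  have : Nontrivial (RN N) := by
    have : Nonempty (Fin N) := ⟨⟨0, hN⟩⟩
    infer_instance
  obtain ⟨C₁, hC₁, h1⟩ := exists_weight_mul_wig_le (N := N) hω hK hτ (add_nonneg hlam hmu) hl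
  obtain ⟨C₂, hC₂, h2⟩ := exists_lintegral_enorm_le (volume : Measure (RN N)) (α := α)
    (by rw [finrank_euclideanSpace_fin]; linarith)
  rw [finrank_euclideanSpace_fin] at h2
  refine ⟨(C₁ * (C₂ * C₂)).toReal + 1, by positivity, fun E xbar ξbar f hf => ?_⟩
  have hfc : Continuous (fourierT f) := hf.smooth_fourier.continuous
  obtain ⟨F, hF⟩ := exists_schwartzMap hb hf
  obtain rfl : ⇑F = f := funext hF
  have hnorm : ∀ g : RN N → ℂ, Continuous g → ∀ y : RN N,
      ∫⁻ x : RN N, ENNReal.ofReal (Real.exp (l * ω ‖x‖)) * ‖g x‖ₑ ≤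
        C₂ * eLpNorm (fun x : RN N => (Real.exp (l * ω ‖x‖) : ℂ) * g x)
          2 volume ^ (1 - (N : ℝ) / (2 * α)) *
        eLpNorm (fun x : RN N => (Real.exp (l * ω ‖x‖) : ℂ) * (((‖x - y‖ ^ α : ℝ) : ℂ) * g x))
          2 volume ^ ((N : ℝ) / (2 * α)) := fun g hg y => by
    have hm : AEStronglyMeasurable (fun x : RN N => (Real.exp (l * ω ‖x‖) : ℂ) * g x) volume :=
      ((Complex.continuous_ofReal.comp (Real.continuous_exp.comp (continuous_const.mul
        (hω.continuous_comp continuous_norm norm_nonneg)))).mul hg).aestronglyMeasurable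
    have h := h2 _ hm y
    simp_rw [enorm_exp_mul, mul_left_comm _ (Complex.ofReal (Real.exp _))] at h
    exact h
  have hpt : ∀ z : RN N × RN N,
      ENNReal.ofReal (Real.exp (lam * ω (phaseNorm z)) * ‖wig τ F z‖) ≤
      ENNReal.ofReal (Real.exp (-(mu * ω (phaseNorm z)))) *
        (C₁ * ((∫⁻ x : RN N, ENNReal.ofReal (Real.exp (l * ω ‖x‖)) * ‖F x‖ₑ) *
          ∫⁻ ξ : RN N, ENNReal.ofReal (Real.exp (l * ω ‖ξ‖)) * ‖fourierT F ξ‖ₑ)) := fun z => by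
    refine le_trans (le_of_eq ?_) (mul_le_mul' le_rfl (h1 F z))
    rw [← mul_assoc, ← ENNReal.ofReal_mul (Real.exp_pos _).le, ← Real.exp_add,
      ENNReal.ofReal_mul (Real.exp_pos _).le, ofReal_norm]
    ring_nf
  refine (lintegral_mono hpt).trans ?_
  have hDm : Measurable fun z : RN N × RN N =>
      ENNReal.ofReal (Real.exp (-(mu * ω (phaseNorm z)))) := by
    simpa only [neg_mul] using hω.measurable_exp (-mu) continuous_phaseNorm phaseNorm_nonneg
  rw [lintegral_mul_const _ hDm]
  refine (mul_le_mul' le_rfl (mul_le_mul' le_rfl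
    (mul_le_mul' (hnorm _ F.continuous xbar) (hnorm _ hfc ξbar)))).trans ?_
  have hCle : C₁ * (C₂ * C₂) ≤ ENNReal.ofReal ((C₁ * (C₂ * C₂)).toReal + 1) :=
    (ENNReal.ofReal_toReal (ENNReal.mul_ne_top hC₁ (ENNReal.mul_ne_top hC₂ hC₂))).symm.le.trans
      (ENNReal.ofReal_le_ofReal (by linarith))
  simp only [mul_assoc]
  refine le_trans (le_of_eq ?_) (mul_le_mul' hCle le_rfl)
  ring

end PointwiseBound

end TimeFreq

/-! ### Checking that the prescribed `λ'` is an admissible rate. -/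

theorem mainTheorem11 (N : ℕ) (hN : 0 < N) (ω : ℝ → ℝ) (hω : TimeFreq.IsWeight ω)
    (K b : ℝ) (hK : TimeFreq.IsDoublingConst ω K) (hb : TimeFreq.IsLogConst ω b)
    (τ : ℝ) (hτ : τ ∈ Set.Ioo (0 : ℝ) 1) :
    (∀ α : ℝ, (N : ℝ) < α →
      ∀ lam mu mu' : ℝ, 0 ≤ lam → 0 ≤ mu → 2 * (N : ℝ) / b < mu' →
      ∃ C : ℝ, 0 < C ∧
        ∀ (E : Set (TimeFreq.RN N)), NullMeasurableSet E volume →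
        ∀ (zbar : TimeFreq.RN N × TimeFreq.RN N) (f : TimeFreq.RN N → ℂ), TimeFreq.MemSω ω f →
        ∀ lam' : ℝ, lam' = 2 * K * (K * (lam + mu) + mu') →
          ∫⁻ ξ in E, ENNReal.ofReal
              (Real.exp (2 * lam * ω ‖ξ‖) * ‖TimeFreq.fourierT f ξ‖ ^ 2) ≤
            ENNReal.ofReal C
              * (∫⁻ ξ in E, ENNReal.ofReal (Real.exp (-(2 * mu * ω ‖ξ‖))))
              * eLpNorm (fun z : TimeFreq.RN N × TimeFreq.RN N =>
                  (Real.exp (lam' * ω (TimeFreq.phaseNorm z)) : ℂ) * TimeFreq.wig τ f z)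
                  2 volume ^ (1 - (N : ℝ) / α)
              * eLpNorm (fun z : TimeFreq.RN N × TimeFreq.RN N =>
                  ((TimeFreq.phaseNorm (z - zbar) ^ α : ℝ) : ℂ) *
                    ((Real.exp (lam' * ω (TimeFreq.phaseNorm z)) : ℂ) * TimeFreq.wig τ f z))
                  2 volume ^ ((N : ℝ) / α)) ∧
    (∀ α : ℝ, (N : ℝ) / 2 < α →
      ∀ lam mu mu' : ℝ, 0 ≤ lam → 0 ≤ mu → 2 * (N : ℝ) / b * (K ^ 2 + 2) < mu' →
      ∃ C : ℝ, 0 < C ∧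
        ∀ (E : Set (TimeFreq.RN N × TimeFreq.RN N)), NullMeasurableSet E volume →
        ∀ (xbar ξbar : TimeFreq.RN N) (f : TimeFreq.RN N → ℂ), TimeFreq.MemSω ω f →
        ∀ lam' : ℝ, lam' = K ^ 2 * (8 * K ^ 4 * (lam + mu) + mu') →
          ∫⁻ z in E, ENNReal.ofReal
              (Real.exp (lam * ω (TimeFreq.phaseNorm z)) * ‖TimeFreq.wig τ f z‖) ≤
            ENNReal.ofReal C
              * (∫⁻ z in E, ENNReal.ofReal (Real.exp (-(mu * ω (TimeFreq.phaseNorm z)))))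
              * eLpNorm (fun x : TimeFreq.RN N => (Real.exp (lam' * ω ‖x‖) : ℂ) * f x)
                  2 volume ^ (1 - (N : ℝ) / (2 * α))
              * eLpNorm (fun x : TimeFreq.RN N =>
                  (Real.exp (lam' * ω ‖x‖) : ℂ) * (((‖x - xbar‖ ^ α : ℝ) : ℂ) * f x))
                  2 volume ^ ((N : ℝ) / (2 * α))
              * eLpNorm (fun ξ : TimeFreq.RN N =>
                  (Real.exp (lam' * ω ‖ξ‖) : ℂ) * TimeFreq.fourierT f ξ)
                  2 volume ^ (1 - (N : ℝ) / (2 * α))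
              * eLpNorm (fun ξ : TimeFreq.RN N =>
                  (Real.exp (lam' * ω ‖ξ‖) : ℂ) *
                    (((‖ξ - ξbar‖ ^ α : ℝ) : ℂ) * TimeFreq.fourierT f ξ))
                  2 volume ^ ((N : ℝ) / (2 * α))) := by
  have hN' : (0 : ℝ) < N := by exact_mod_cast hN
  have hK1 := hK.1
  have hb0 := hb.1
  constructor
  · intro α hα lam mu mu' hlam hmu hmu'
    have hKK : 1 ≤ K * K := by nlinarith
    have h1 : (N : ℝ) < b * mu' := by
      rw [div_lt_iff₀ hb0] at hmu'
      nlinarith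
    have hmu0 : 0 < mu' := lt_trans (by positivity) hmu'
    -- Since `K ≥ 1`, the rate exceeds `2 (lam + mu)` by at least `mu'`, and `b mu' > N`.
    have h2 : 2 * (lam + mu) + mu' ≤ 2 * K * (K * (lam + mu) + mu') := by
      nlinarith [mul_le_mul_of_nonneg_right hKK (add_nonneg hlam hmu),
        mul_le_mul_of_nonneg_right hK1 hmu0.le]
    obtain ⟨C, hC, h⟩ := TimeFreq.setLIntegral_fourierT_le (τ := τ) hN hω hb hτ.1.ne' hα hlam hmu
      (l := 2 * K * (K * (lam + mu) + mu')) (by linarith)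
      (h1.trans_le (mul_le_mul_of_nonneg_left (by linarith) hb0.le))
    exact ⟨C, hC, fun E _ zbar f hf l hl => hl ▸ h E zbar f hf⟩
  · intro α hα lam mu mu' hlam hmu hmu'
    have hmu0 : 0 < mu' := lt_trans (by positivity) hmu'
    -- The pointwise bound asks of the rate only that it be at least `K (lam + mu)`.
    have h1 : K * (lam + mu) ≤ K ^ 2 * (8 * K ^ 4 * (lam + mu) + mu') := by
      have hs : 0 ≤ lam + mu := add_nonneg hlam hmu
      have hK2 : K ≤ K ^ 2 := le_self_pow₀ hK1 two_ne_zero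
      have h3 : lam + mu ≤ 8 * K ^ 4 * (lam + mu) :=
        le_mul_of_one_le_left hs (by linarith [one_le_pow₀ hK1 (n := 4)])
      exact mul_le_mul hK2 (by linarith) hs (by positivity)
    obtain ⟨C, hC, h⟩ := TimeFreq.setLIntegral_wig_le hN hω hK hb hτ hα hlam hmu h1
    exact ⟨C, hC, fun E _ xbar ξbar f hf l hl => hl ▸ h E xbar ξbar f hf⟩
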